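/- Let $\Xi$ be a complete separable metric space. All compact metric spaces below are nonempty, and products carry the max metric. Let $\mathcal T$ be the set of equivalence classes of pairs $(X,\varphi)$ of a compact metric space $X$ and a continuous function $\varphi:X\to\Xi$, where $(X,\varphi)$ and $(Y,\psi)$ are equivalent if $\psi\circ e=\varphi$ for some isometry $e$ of $X$ onto $Y$, with the distance $$d\big((X,\varphi),(Y,\psi)\big)=\inf_R\Big\{\tfrac12\,\mathrm{dis}(R)\ \vee\sup_{(x,y)\in R} d(\varphi(x),\psi(y))\Big\}.$$ Here $R$ runs over all correspondences of $X$ and $Y$, that is, all $R\subseteq X\times Y$ which project onto $X$ and onto $Y$, and $\mathrm{dis}(R)=\sup\{|d(x,x')-d(y,y')| : (x,y),(x',y')\in R\}$. Let $\mathcal T_*$ be the set of equivalence classes of triples $(X,o,\varphi)$ with in addition a root $o\in X$ (the isometries preserve roots), with the same formula for the distance, where only those $R$ are allowed that contain the pair of the two roots. For a compact metric space $X$, let $\tau(X)$ be the set of nonempty compact subsets of $X\times\Xi$ (1-marked compact subsets of $X$) with the Hausdorff metric, and let $\tau_*(X)=X\times\tau(X)$. For an isometric embedding $f:X\to Z$,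 let $\tau_f(K)=\{(f(x),\xi):(x,\xi)\in K\}$ and $(\tau_*)_f(o,K)=(f(o),\tau_f(K))$. For $\sigma\in\{\tau,\tau_*\}$, let $\mathcal C_\sigma$ be the set of pairs $(X,a)$ of a compact metric space $X$ and $a\in\sigma(X)$, where $(X,a)$ and $(X',a')$ are identified if $\sigma_e(a)=a'$ for some isometry $e$ of $X$ onto $X'$, with the distance $$d\big((X,a),(Y,b)\big)=\inf_{Z,f,g}\big\{d_H(f(X),g(Y))\vee d(\sigma_f(a),\sigma_g(b))\big\},$$ where $d_H$ is the Hausdorff distance and the infimum is over all compact metric spaces $Z$ and all isometric embeddings $f:X\to Z$ and $g:Y\to Z$. **Proposition.** The distances above are metrics on $\mathcal T$, $\mathcal T_*$, $\mathcal C_\tau$ and $\mathcal C_{\tau_*}$, and $\mathcal C_\tau$ and $\mathcal C_{\tau_*}$ are complete and separable. The map $(X,\varphi)\mapsto(X,\mathrm{gr}_\varphi)$, where $\mathrm{gr}_\varphi=\{(x,\varphi(x)):x\in X\}$, is an isometric embedding of $\mathcal T$ into $\mathcal C_\tau$, and its image is an $F_{\sigma\delta}$ subset, hence a Borel subset, of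 $\mathcal C_\tau$. The map $(X,o,\varphi)\mapsto(X,(o,\mathrm{gr}_\varphi))$ is a homeomorphism of $\mathcal T_*$ onto its image in $\mathcal C_{\tau_*}$, which is an $F_{\sigma\delta}$ subset, hence a Borel subset, of $\mathcal C_{\tau_*}$. -/

import Mathlib

open Set TopologicalSpace

universe u v w

noncomputable section

namespace SpatialTrees

/-! ### Compact metric spaces and functors on them -/

/-- An object of the category of (nonempty) compact metric spaces. -/
structure CompObj : Type (u + 1) where
  carrier : Type u
  [metric : MetricSpace carrier]
  [compact : CompactSpace carrier]
  [nonempty : Nonempty carrier]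

instance : CoeSort CompObj.{u} (Type u) := ⟨CompObj.carrier⟩

attribute [instance] CompObj.metric CompObj.compact CompObj.nonempty

/-- A functor from compact metric spaces to metric spaces, where the morphisms on both sides are
the isometric embeddings. -/
structure CompFunctor : Type (max (u + 1) (w + 1)) where
  obj : CompObj.{u} → Type w
  [metric : ∀ X, MetricSpace (obj X)]
  map : ∀ {X Y : CompObj.{u}} (f : X → Y), Isometry f → obj X → obj Y
  isometry_map : ∀ {X Y : CompObj.{u}} (f : X → Y) (hf : Isometry f), Isometry (map f hf)
  map_id : ∀ (X : CompObj.{u}) (a : obj X), map (id : X → X) isometry_id a = a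
  map_comp : ∀ {X Y Z : CompObj.{u}} (f : X → Y) (g : Y → Z) (hf : Isometry f) (hg : Isometry g)
    (a : obj X), map (g ∘ f) (hg.comp hf) a = map g hg (map f hf a)

attribute [instance] CompFunctor.metric

/-- Pairs `(X, a)` of a compact metric space `X` and an additional structure `a ∈ τ(X)`. -/
structure Structured (τ : CompFunctor.{u, w}) : Type (max (u + 1) w) where
  space : CompObj.{u}
  str : τ.obj space

/-- `(X, a)` and `(Y, b)` are equivalent if some isometry of `X` onto `Y` maps `a` to `b`. -/
def Structured.Equivalent {τ : CompFunctor.{u, w}} (p q : Structured τ) : Prop :=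
  ∃ e : p.space ≃ᵢ q.space, τ.map e e.isometry p.str = q.str

theorem Structured.equivalence (τ : CompFunctor.{u, w}) :
    Equivalence (Structured.Equivalent (τ := τ)) where
  refl p := ⟨IsometryEquiv.refl _, τ.map_id _ _⟩
  symm := by
    rintro p q ⟨e, he⟩
    refine ⟨e.symm, ?_⟩
    rw [← he, ← τ.map_comp e e.symm e.isometry e.symm.isometry]
    have : (e.symm : q.space → p.space) ∘ e = id := by ext x; simp
    simp only [this]
    exact τ.map_id _ _
  trans := by
    rintro p q r ⟨e, he⟩ ⟨e', he'⟩
    refine ⟨e.trans e', ?_⟩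
    rw [← he', ← he, ← τ.map_comp e e' e.isometry e'.isometry]
    rfl

instance Structured.setoid (τ : CompFunctor.{u, w}) : Setoid (Structured τ) :=
  ⟨Structured.Equivalent, Structured.equivalence τ⟩

/-- The set `𝒞_τ` of equivalence classes of pairs `(X, a)`. -/
def CSpace (τ : CompFunctor.{u, w}) : Type (max (u + 1) w) :=
  Quotient (Structured.setoid τ)

/-- The Gromov–Hausdorff-functor distance on `𝒞_τ`: the infimum of
`d_H(f(X), g(Y)) ∨ d(τ_f(a), τ_g(b))` over all compact metric spaces `Z`, all isometric embeddings
`f : X → Z` and `g : Y → Z`, and all representatives `(X, a)`, `(Y, b)` of the two classes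
(the infimum over `Z, f, g` does not depend on the representatives). -/
def ghfDist (τ : CompFunctor.{u, w}) (p q : CSpace τ) : ℝ :=
  sInf {r : ℝ | ∃ P Q : Structured τ, (⟦P⟧ : CSpace τ) = p ∧ (⟦Q⟧ : CSpace τ) = q ∧
    ∃ (Z : CompObj.{u}) (f : P.space → Z) (g : Q.space → Z) (hf : Isometry f) (hg : Isometry g),
      r = max (Metric.hausdorffDist (range f) (range g))
        (dist (τ.map f hf P.str) (τ.map g hg Q.str))}

/-! ### Points, 1-marked compact subsets, and pairs of these -/

/-- The functor `τ(X) = X`. -/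
def pointFunctor : CompFunctor.{u, u} where
  obj X := X
  map f _ := f
  isometry_map _ hf := hf
  map_id _ _ := rfl
  map_comp _ _ _ _ _ := rfl

theorem isometry_nonemptyCompacts_map {α β : Type*} [MetricSpace α] [MetricSpace β] (f : α → β)
    (hf : Isometry f) : Isometry (NonemptyCompacts.map f hf.continuous) := by
  refine Isometry.of_dist_eq fun K L => ?_
  simp only [Metric.NonemptyCompacts.dist_eq, NonemptyCompacts.coe_map,
    Metric.hausdorffDist_image hf]

theorem isometry_markMap (Ξ : Type v) [MetricSpace Ξ] {X Y : CompObj.{u}} (f : X → Y)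
    (hf : Isometry f) : Isometry (Prod.map f id : X × Ξ → Y × Ξ) :=
  hf.prodMap isometry_id

/-- The functor of 1-marked compact subsets with mark space `Ξ`: `τ(X)` is the set of nonempty
compact subsets of `X × Ξ` (max product metric) with the Hausdorff metric, and `τ_f` is the image
under `(x, ξ) ↦ (f x, ξ)`. -/
def markedFunctor (Ξ : Type v) [MetricSpace Ξ] : CompFunctor.{u, max u v} where
  obj X := NonemptyCompacts (X × Ξ)
  map f hf := NonemptyCompacts.map (Prod.map f id) (isometry_markMap Ξ f hf).continuous
  isometry_map f hf := isometry_nonemptyCompacts_map _ (isometry_markMap Ξ f hf)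
  map_id X K := by
    ext z
    simp
  map_comp f g hf hg K := by
    refine NonemptyCompacts.ext ?_
    simp only [NonemptyCompacts.coe_map, ← image_comp]
    rfl

/-- The product of two functors, with the max product metric on `τ₁(X) × τ₂(X)`. -/
def prodFunctor (τ₁ : CompFunctor.{u, v}) (τ₂ : CompFunctor.{u, w}) :
    CompFunctor.{u, max v w} where
  obj X := τ₁.obj X × τ₂.obj X
  map f hf := Prod.map (τ₁.map f hf) (τ₂.map f hf)
  isometry_map f hf := (τ₁.isometry_map f hf).prodMap (τ₂.isometry_map f hf)
  map_id X a := Prod.ext (τ₁.map_id X a.1) (τ₂.map_id X a.2)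
  map_comp f g hf hg a := Prod.ext (τ₁.map_comp f g hf hg a.1) (τ₂.map_comp f g hf hg a.2)

/-- The functor whose structures are pairs of a point and a 1-marked compact subset. -/
def pointedMarkedFunctor (Ξ : Type v) [MetricSpace Ξ] : CompFunctor.{u, max u v} :=
  prodFunctor pointFunctor.{u} (markedFunctor.{u, v} Ξ)

/-! ### Correspondences -/

/-- `R` is a correspondence between `X` and `Y`: both projections of `R` are onto. -/
def IsCorrespondence {X Y : Type*} (R : Set (X × Y)) : Prop :=
  Prod.fst '' R = univ ∧ Prod.snd '' R = univ

/-- The distortion of a relation. -/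
def distortion {X Y : Type*} [MetricSpace X] [MetricSpace Y] (R : Set (X × Y)) : ℝ :=
  sSup {r : ℝ | ∃ p ∈ R, ∃ q ∈ R, r = |dist p.1 q.1 - dist p.2 q.2|}

/-- The quantity `½ dis(R) ∨ sup_{(x, y) ∈ R} d(φ(x), ψ(y))`. -/
def correspondenceCost {X Y Ξ : Type*} [MetricSpace X] [MetricSpace Y] [MetricSpace Ξ]
    (φ : X → Ξ) (ψ : Y → Ξ) (R : Set (X × Y)) : ℝ :=
  max (1 / 2 * distortion R) (sSup {r : ℝ | ∃ p ∈ R, r = dist (φ p.1) (ψ p.2)})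

/-! ### Compact metric spaces with a continuous function to `Ξ` -/

/-- Pairs `(X, φ)` of a compact metric space `X` and a continuous function `φ : X → Ξ`. -/
structure FunctionSpace (Ξ : Type v) [MetricSpace Ξ] : Type (max (u + 1) v) where
  space : CompObj.{u}
  func : C(space, Ξ)

/-- `(X, φ)` and `(Y, ψ)` are equivalent if `ψ ∘ e = φ` for some isometry `e` of `X` onto `Y`. -/
def FunctionSpace.Equivalent {Ξ : Type v} [MetricSpace Ξ] (p q : FunctionSpace.{u, v} Ξ) : Prop :=
  ∃ e : p.space ≃ᵢ q.space, ∀ x, q.func (e x) = p.func x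

instance FunctionSpace.setoid (Ξ : Type v) [MetricSpace Ξ] : Setoid (FunctionSpace.{u, v} Ξ) where
  r := FunctionSpace.Equivalent
  iseqv :=
    { refl := fun p => ⟨IsometryEquiv.refl _, fun _ => rfl⟩
      symm := by
        rintro p q ⟨e, he⟩
        exact ⟨e.symm, fun y => by rw [← he, e.apply_symm_apply]⟩
      trans := by
        rintro p q r ⟨e, he⟩ ⟨e', he'⟩
        exact ⟨e.trans e', fun x => (he' (e x)).trans (he x)⟩ }

/-- The set `𝒯` of equivalence classes of pairs `(X, φ)`. -/
def TSpace (Ξ : Type v) [MetricSpace Ξ] : Type (max (u + 1) v) :=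
  Quotient (FunctionSpace.setoid.{u, v} Ξ)

/-- The distance on `𝒯`: the infimum of `½ dis(R) ∨ sup_{(x, y) ∈ R} d(φ(x), ψ(y))` over all
correspondences `R` (and all representatives of the two classes, on which it does not depend). -/
def tDist {Ξ : Type v} [MetricSpace Ξ] (p q : TSpace.{u, v} Ξ) : ℝ :=
  sInf {r : ℝ | ∃ P Q : FunctionSpace.{u, v} Ξ,
    (⟦P⟧ : TSpace Ξ) = p ∧ (⟦Q⟧ : TSpace Ξ) = q ∧
      ∃ R : Set (P.space × Q.space), IsCorrespondence R ∧
        r = correspondenceCost P.func Q.func R}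

/-- Triples `(X, o, φ)` of a compact metric space `X`, a root `o ∈ X` and a continuous function
`φ : X → Ξ`. -/
structure PointedFunctionSpace (Ξ : Type v) [MetricSpace Ξ] : Type (max (u + 1) v) where
  space : CompObj.{u}
  root : space
  func : C(space, Ξ)

/-- Equivalence of triples: by an isometry which preserves the roots and the functions. -/
def PointedFunctionSpace.Equivalent {Ξ : Type v} [MetricSpace Ξ]
    (p q : PointedFunctionSpace.{u, v} Ξ) : Prop :=
  ∃ e : p.space ≃ᵢ q.space, e p.root = q.root ∧ ∀ x, q.func (e x) = p.func x

instance PointedFunctionSpace.setoid (Ξ : Type v) [MetricSpace Ξ] :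
    Setoid (PointedFunctionSpace.{u, v} Ξ) where
  r := PointedFunctionSpace.Equivalent
  iseqv :=
    { refl := fun p => ⟨IsometryEquiv.refl _, rfl, fun _ => rfl⟩
      symm := by
        rintro p q ⟨e, ho, he⟩
        exact ⟨e.symm, by rw [← ho, e.symm_apply_apply],
          fun y => by rw [← he, e.apply_symm_apply]⟩
      trans := by
        rintro p q r ⟨e, ho, he⟩ ⟨e', ho', he'⟩
        exact ⟨e.trans e', (congrArg e' ho).trans ho', fun x => (he' (e x)).trans (he x)⟩ }

/-- The set `𝒯_*` of equivalence classes of triples `(X, o, φ)`. -/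
def PointedTSpace (Ξ : Type v) [MetricSpace Ξ] : Type (max (u + 1) v) :=
  Quotient (PointedFunctionSpace.setoid.{u, v} Ξ)

/-- The distance on `𝒯_*`: as on `𝒯`, but only with correspondences that contain the pair of the
two roots. -/
def pointedTDist {Ξ : Type v} [MetricSpace Ξ] (p q : PointedTSpace.{u, v} Ξ) : ℝ :=
  sInf {r : ℝ | ∃ P Q : PointedFunctionSpace.{u, v} Ξ,
    (⟦P⟧ : PointedTSpace Ξ) = p ∧ (⟦Q⟧ : PointedTSpace Ξ) = q ∧
      ∃ R : Set (P.space × Q.space), IsCorrespondence R ∧ (P.root, Q.root) ∈ R ∧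
        r = correspondenceCost P.func Q.func R}

/-! ### Identification of functions with their graphs -/

/-- The graph `{(x, φ(x)) : x ∈ X}` as a nonempty compact subset of `X × Ξ`. -/
def graphCompact {Ξ : Type v} [MetricSpace Ξ] (X : CompObj.{u}) (φ : C(X, Ξ)) :
    NonemptyCompacts (X × Ξ) where
  carrier := range fun x => (x, φ x)
  isCompact' := isCompact_range (by fun_prop)
  nonempty' := range_nonempty _

theorem map_graphCompact {Ξ : Type v} [MetricSpace Ξ] {X Y : CompObj.{u}} (φ : C(X, Ξ))
    (ψ : C(Y, Ξ)) (e : X ≃ᵢ Y) (he : ∀ x, ψ (e x) = φ x) :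
    (markedFunctor.{u, v} Ξ).map e e.isometry (graphCompact X φ) = graphCompact Y ψ := by
  refine NonemptyCompacts.ext ?_
  change Prod.map e id '' (range fun x => (x, φ x)) = range fun y => (y, ψ y)
  rw [← range_comp]
  refine Eq.trans ?_ (e.surjective.range_comp fun y => (y, ψ y))
  congr 1
  funext x
  simp [he]

/-- The map `𝒯 → 𝒞_τ`, `(X, φ) ↦ (X, graph of φ)`. -/
def graphMap (Ξ : Type v) [MetricSpace Ξ] : TSpace.{u, v} Ξ → CSpace (markedFunctor.{u, v} Ξ) :=
  Quotient.map (fun P => ⟨P.space, graphCompact P.space P.func⟩) (by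
    rintro P Q ⟨e, he⟩
    exact ⟨e, map_graphCompact P.func Q.func e he⟩)

/-- The map `𝒯_* → 𝒞_τ`, `(X, o, φ) ↦ (X, (o, graph of φ))`. -/
def pointedGraphMap (Ξ : Type v) [MetricSpace Ξ] :
    PointedTSpace.{u, v} Ξ → CSpace (pointedMarkedFunctor.{u, v} Ξ) :=
  Quotient.map (fun P => ⟨P.space, (P.root, graphCompact P.space P.func)⟩) (by
    rintro P Q ⟨e, ho, he⟩
    exact ⟨e, Prod.ext ho (map_graphCompact P.func Q.func e he)⟩)

/-- `F_{σδ}` sets: countable intersections of countable unions of closed sets. -/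
def IsFSigmaDelta {α : Type*} [TopologicalSpace α] (S : Set α) : Prop :=
  ∃ F : ℕ → ℕ → Set α, (∀ n m, IsClosed (F n m)) ∧ S = ⋂ n, ⋃ m, F n m

end SpatialTrees

end

noncomputable section

namespace SpatialTrees

open Filter Topology Metric

section

/-! ### Regular functors -/

/-! The statements about `𝒞_τ` rest on a few abstract properties of the functor, collected in
`CompFunctor.IsRegular`; they hold for points and for marked compact sets and pass to products. The
triangle inequality needs none of them: two couplings are glued along the middle space. Separation
holds because couplings at distance tending to zero define almost isometric maps, which converge
along an ultrafilter to an isometry that carries one structure to the other. For completeness, a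
rapidly Cauchy sequence of spaces is realized inside one complete space, where both the spaces and
their structures converge. For separability, a finite net, its rounded distances and a code of the
structure relative to the net take only countably many values and determine the class up to a small
error.

A correspondence of cost less than `r` lets the two spaces be glued with paired points at distance
less than `r`, so the graphs are Hausdorff close. Conversely, in a coupling with close graphs, the
pairs of points that are close together with their marks form a correspondence of small cost. Hence
`tDist_eq_ghfDist`. With roots the converse is only qualitative: the roots may be close while their
marks are not, so the pair of roots has to be added to the correspondence, at a cost governed by the
modulus of continuity of one fixed function (`exists_pointedTDist_lt_of_ghfDist_lt`). This gives a
homeomorphism onto the image.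

A compact `K ⊆ X × Ξ` is the graph of a continuous function if and only if it projects onto `X` and
for every `η` there is a `δ` such that marks at points closer than `δ` differ by at most `η`. For
fixed `δ` and `η` the condition is closed (`hasModulus_of_near`), whence `F_{σδ}`. The rooted image
is the preimage of the unrooted one under the 1-Lipschitz map that forgets the root. -/

theorem CompFunctor.map_congr (τ : CompFunctor.{u, w}) {X Z : CompObj.{u}} {f f' : X → Z}
    (h : f = f') (hf : Isometry f) (hf' : Isometry f') (a : τ.obj X) :
    τ.map f hf a = τ.map f' hf' a := by
  subst h; rfl

/-- The properties of a functor that make `𝒞_τ` a complete separable metric space. -/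
structure CompFunctor.IsRegular (τ : CompFunctor.{u, w}) : Prop where
  /-- `f ↦ τ_f(a)` is nonexpansive with respect to the supremum distance. -/
  dist_map_le : ∀ {X Z : CompObj.{u}} (f g : X → Z) (hf : Isometry f) (hg : Isometry g)
    (a : τ.obj X) (r : ℝ), (∀ x, dist (f x) (g x) ≤ r) → dist (τ.map f hf a) (τ.map g hg a) ≤ r
  complete : ∀ X, CompleteSpace (τ.obj X)
  /-- Structures on subspaces of `Z` are preserved under limits. -/
  exists_map_eq_of_tendsto : ∀ {Z X : CompObj.{u}} (Y : ℕ → CompObj.{u}) (f : ∀ n, Y n → Z)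
    (hf : ∀ n, Isometry (f n)) (g : X → Z) (hg : Isometry g),
    Tendsto (fun n => hausdorffDist (range (f n)) (range g)) atTop (𝓝 0) →
    ∀ (b : ∀ n, τ.obj (Y n)) (a : τ.obj Z),
      Tendsto (fun n => τ.map (f n) (hf n) (b n)) atTop (𝓝 a) → ∃ c, τ.map g hg c = a
  /-- Structures are determined approximately by countably many data on finite nets. -/
  exists_code : ∀ ε > (0 : ℝ), ∃ code : ∀ (X : CompObj.{u}) (n : ℕ), (Fin n → X) → τ.obj X → ℕ,
    ∀ {X Y Z : CompObj.{u}} {n : ℕ} (s : Fin n → X) (t : Fin n → Y),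
      (∀ x, ∃ i, dist x (s i) < ε) → (∀ y, ∃ i, dist y (t i) < ε) →
      ∀ (a : τ.obj X) (b : τ.obj Y), code X n s a = code Y n t b →
      ∀ (f : X → Z) (g : Y → Z) (hf : Isometry f) (hg : Isometry g),
        (∀ i, dist (f (s i)) (g (t i)) ≤ ε) → dist (τ.map f hf a) (τ.map g hg b) ≤ 3 * ε

/-! ### The Gromov–Hausdorff-functor distance -/

theorem hausdorffEDist_range_ne_top {X Y : CompObj.{u}} {Z : Type*} [MetricSpace Z] {f : X → Z}
    {g : Y → Z} (hf : Isometry f) (hg : Isometry g) :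
    hausdorffEDist (range f) (range g) ≠ ⊤ :=
  hausdorffEDist_ne_top_of_nonempty_of_bounded (range_nonempty _) (range_nonempty _)
    (isCompact_range hf.continuous).isBounded (isCompact_range hg.continuous).isBounded

/-- `P` and `Q` can be embedded into a common space at distance less than `r`. -/
def Structured.Near {τ : CompFunctor.{u, w}} (P Q : Structured τ) (r : ℝ) : Prop :=
  ∃ (Z : CompObj.{u}) (f : P.space → Z) (g : Q.space → Z) (hf : Isometry f) (hg : Isometry g),
    hausdorffDist (range f) (range g) < r ∧ dist (τ.map f hf P.str) (τ.map g hg Q.str) < r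

/-- Approximately isometric families can be placed at distance `ε` in a common space. -/
theorem exists_gluing_of_distortion_le {X Y : CompObj.{u}} {ι : Type*} [Nonempty ι] (s : ι → X)
    (t : ι → Y) {ε : ℝ} (hε : 0 < ε)
    (h : ∀ i j, |dist (s i) (s j) - dist (t i) (t j)| ≤ 2 * ε) :
    ∃ (Z : CompObj.{u}) (f : X → Z) (g : Y → Z), Isometry f ∧ Isometry g ∧
      ∀ i, dist (f (s i)) (g (t i)) = ε := by
  let _ : MetricSpace (X ⊕ Y) := glueMetricApprox s t ε hε h
  have hl : Isometry (Sum.inl : X → X ⊕ Y) := Isometry.of_dist_eq fun _ _ => rfl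
  have hr : Isometry (Sum.inr : Y → X ⊕ Y) := Isometry.of_dist_eq fun _ _ => rfl
  have : CompactSpace (X ⊕ Y) := by
    constructor
    rw [← range_inl_union_range_inr]
    exact (isCompact_range hl.continuous).union (isCompact_range hr.continuous)
  exact ⟨⟨X ⊕ Y⟩, Sum.inl, Sum.inr, hl, hr, fun i => glueDist_glued_points s t ε i⟩

variable {τ : CompFunctor.{u, w}}

/-- Isometries between representatives can be absorbed into the embeddings, so representatives may
be fixed once and for all. All later work with the distance goes through this form. -/
theorem ghfDist_lt_iff (P Q : Structured τ) (r : ℝ) :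
    ghfDist τ ⟦P⟧ ⟦Q⟧ < r ↔ P.Near Q r := by
  constructor
  · intro h
    -- Since `sInf ∅ = 0` in `ℝ`, nonemptiness is needed; gluing one point of each space at distance
    -- 1 provides a coupling.
    have hne : {r : ℝ | ∃ P' Q' : Structured τ, (⟦P'⟧ : CSpace τ) = ⟦P⟧ ∧
        (⟦Q'⟧ : CSpace τ) = ⟦Q⟧ ∧ ∃ (Z : CompObj.{u}) (f : P'.space → Z) (g : Q'.space → Z)
          (hf : Isometry f) (hg : Isometry g), r = max (hausdorffDist (range f) (range g))
            (dist (τ.map f hf P'.str) (τ.map g hg Q'.str))}.Nonempty := by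
      obtain ⟨Z, f, g, hf, hg, -⟩ := exists_gluing_of_distortion_le
        (fun _ : Unit => Classical.arbitrary P.space) (fun _ => Classical.arbitrary Q.space)
        one_pos (by simp)
      exact ⟨_, P, Q, rfl, rfl, Z, f, g, hf, hg, rfl⟩
    obtain ⟨_, ⟨P', Q', hP, hQ, Z, f, g, hf, hg, rfl⟩, hr⟩ := exists_lt_of_csInf_lt hne h
    obtain ⟨e, he⟩ : Structured.Equivalent P P' := Quotient.exact hP.symm
    obtain ⟨e', he'⟩ : Structured.Equivalent Q Q' := Quotient.exact hQ.symm
    rw [max_lt_iff] at hr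
    refine ⟨Z, f ∘ e, g ∘ e', hf.comp e.isometry, hg.comp e'.isometry, ?_, ?_⟩
    · rw [e.surjective.range_comp, e'.surjective.range_comp]
      exact hr.1
    · rw [τ.map_comp e f e.isometry hf, τ.map_comp e' g e'.isometry hg, he, he']
      exact hr.2
  · rintro ⟨Z, f, g, hf, hg, h1, h2⟩
    refine lt_of_le_of_lt (csInf_le ⟨0, ?_⟩ ⟨P, Q, rfl, rfl, Z, f, g, hf, hg, rfl⟩)
      (max_lt h1 h2)
    rintro _ ⟨_, _, _, _, _, _, _, _, _, rfl⟩
    exact le_max_of_le_right dist_nonneg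

theorem ghfDist_nonneg (p q : CSpace τ) : 0 ≤ ghfDist τ p q := by
  refine Real.sInf_nonneg ?_
  rintro _ ⟨_, _, _, _, _, _, _, _, _, rfl⟩
  exact le_max_of_le_right dist_nonneg

theorem ghfDist_self (p : CSpace τ) : ghfDist τ p p = 0 := by
  refine Quotient.inductionOn p fun P => le_antisymm ?_ (ghfDist_nonneg _ _)
  refine le_of_forall_pos_lt_add fun ε hε => ?_
  rw [zero_add, ghfDist_lt_iff]
  exact ⟨P.space, id, id, isometry_id, isometry_id, by simpa, by simpa⟩

theorem Structured.Near.symm {P Q : Structured τ} {r : ℝ} (h : P.Near Q r) : Q.Near P r := by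
  obtain ⟨Z, f, g, hf, hg, h1, h2⟩ := h
  exact ⟨Z, g, f, hg, hf, by rwa [hausdorffDist_comm], by rwa [dist_comm]⟩

theorem ghfDist_comm (p q : CSpace τ) : ghfDist τ p q = ghfDist τ q p := by
  refine Quotient.inductionOn₂ p q fun P Q => le_antisymm ?_ ?_ <;>
  refine le_of_forall_gt fun r hr => ?_ <;> rw [ghfDist_lt_iff] at * <;> exact hr.symm

instance compactSpace_glueSpace {X Y Z : Type u} [Nonempty Z] [MetricSpace X] [MetricSpace Y]
    [MetricSpace Z] [CompactSpace X] [CompactSpace Y] {Φ : Z → X} {Ψ : Z → Y}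
    (hΦ : Isometry Φ) (hΨ : Isometry Ψ) : CompactSpace (GlueSpace hΦ hΨ) := by
  constructor
  have : range (toGlueL hΦ hΨ) ∪ range (toGlueR hΦ hΨ) = univ := by
    refine eq_univ_of_forall fun z => ?_
    obtain ⟨z, rfl⟩ := Quotient.exists_rep z
    rcases z with x | y
    · exact Or.inl ⟨x, rfl⟩
    · exact Or.inr ⟨y, rfl⟩
  rw [← this]
  exact (isCompact_range (toGlueL_isometry hΦ hΨ).continuous).union
    (isCompact_range (toGlueR_isometry hΦ hΨ).continuous)

/-- Gluing the two ambient spaces along the common copy of `Q` identifies both images of its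
structure, so the ordinary triangle inequality applies in the glued space. -/
theorem Structured.Near.trans {P Q R : Structured τ} {r s : ℝ} (h : P.Near Q r)
    (h' : Q.Near R s) : P.Near R (r + s) := by
  obtain ⟨Z, f, g, hf, hg, h1, h2⟩ := h
  obtain ⟨Z', f', g', hf', hg', h1', h2'⟩ := h'
  have : Nonempty (GlueSpace hg hf') := ⟨toGlueL hg hf' (Classical.arbitrary _)⟩
  set W : CompObj.{u} := ⟨GlueSpace hg hf'⟩
  let l : Z → W := toGlueL hg hf'
  let m : Z' → W := toGlueR hg hf'
  have hl : Isometry l := toGlueL_isometry hg hf'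
  have hm : Isometry m := toGlueR_isometry hg hf'
  have hc : l ∘ g = m ∘ f' := toGlue_commute hg hf'
  refine ⟨W, l ∘ f, m ∘ g', hl.comp hf, hm.comp hg', ?_, ?_⟩
  · refine lt_of_le_of_lt (hausdorffDist_triangle (t := range (l ∘ g))
      (hausdorffEDist_range_ne_top (hl.comp hf) (hl.comp hg))) (add_lt_add ?_ ?_)
    · rwa [range_comp, range_comp, hausdorffDist_image hl]
    · rwa [hc, range_comp, range_comp, hausdorffDist_image hm]
  · refine lt_of_le_of_lt (dist_triangle _ (τ.map (l ∘ g) (hl.comp hg) Q.str) _)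
      (add_lt_add ?_ ?_)
    · rwa [τ.map_comp f l hf hl, τ.map_comp g l hg hl, (τ.isometry_map l hl).dist_eq]
    · rwa [τ.map_congr hc (hl.comp hg) (hm.comp hf'), τ.map_comp f' m hf' hm,
        τ.map_comp g' m hg' hm, (τ.isometry_map m hm).dist_eq]

theorem ghfDist_triangle (p q r : CSpace τ) :
    ghfDist τ p r ≤ ghfDist τ p q + ghfDist τ q r := by
  obtain ⟨P, rfl⟩ := Quotient.exists_rep p
  obtain ⟨Q, rfl⟩ := Quotient.exists_rep q
  obtain ⟨R, rfl⟩ := Quotient.exists_rep r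
  refine le_of_forall_pos_lt_add fun ε hε => ?_
  have h1 := (ghfDist_lt_iff P Q _).1 (lt_add_of_pos_right _ (half_pos hε))
  have h2 := (ghfDist_lt_iff Q R _).1 (lt_add_of_pos_right _ (half_pos hε))
  rw [ghfDist_lt_iff]
  convert h1.trans h2 using 1
  ring

/-- Approximately matching isometric embeddings yield an isometry in the limit. -/
theorem exists_isometryEquiv_of_hausdorffDist_lt {X Y : CompObj.{u}} (Z : ℕ → CompObj.{u})
    (f : ∀ n, X → Z n) (g : ∀ n, Y → Z n) (hf : ∀ n, Isometry (f n)) (hg : ∀ n, Isometry (g n))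
    (r : ℕ → ℝ) (hr : Tendsto r atTop (𝓝 0))
    (h : ∀ n, hausdorffDist (range (f n)) (range (g n)) < r n) :
    ∃ e : X ≃ᵢ Y, ∃ c : ℕ → ℝ, (∀ n x, dist (f n x) (g n (e x)) ≤ c n) ∧
      Tendsto c (hyperfilter ℕ) (𝓝 0) := by
  have hr' : Tendsto r (hyperfilter ℕ) (𝓝 0) := hr.mono_left Nat.hyperfilter_le_atTop
  have h1 : ∀ n x, ∃ y, dist (f n x) (g n y) < r n := fun n x => by
    obtain ⟨_, ⟨y, rfl⟩, hy⟩ := exists_dist_lt_of_hausdorffDist_lt (mem_range_self x) (h n)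
      (hausdorffEDist_range_ne_top (hf n) (hg n))
    exact ⟨y, hy⟩
  have h2 : ∀ n y, ∃ x, dist (f n x) (g n y) < r n := fun n y => by
    obtain ⟨_, ⟨x, rfl⟩, hx⟩ := exists_dist_lt_of_hausdorffDist_lt' (mem_range_self y) (h n)
      (hausdorffEDist_range_ne_top (hf n) (hg n))
    exact ⟨x, hx⟩
  choose u hu using h1
  choose v hv using h2
  -- In a compact space every sequence converges along the ultrafilter, so all limits exist at once
  -- and no diagonal subsequence is needed.
  have lim : ∀ {A : CompObj.{u}} (s : ℕ → A), ∃ a, Tendsto s (hyperfilter ℕ) (𝓝 a) := by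
    intro A s
    obtain ⟨a, -, ha⟩ := isCompact_univ.ultrafilter_le_nhds ((hyperfilter ℕ).map s) (by simp)
    exact ⟨a, ha⟩
  choose e he using fun x => lim fun n => u n x
  have hgf : ∀ n x x', |dist (u n x) (u n x') - dist x x'| ≤ 2 * r n := fun n x x' => by
    rw [← (hf n).dist_eq x x', ← (hg n).dist_eq, ← Real.dist_eq]
    refine (dist_dist_dist_le _ _ _ _).trans ?_
    rw [dist_comm (g n (u n x)), dist_comm (g n (u n x'))]
    linarith [hu n x, hu n x']
  have e_isom : Isometry e := by
    refine Isometry.of_dist_eq fun x x' => ?_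
    have t1 : Tendsto (fun n => dist (u n x) (u n x') - dist x x') (hyperfilter ℕ)
        (𝓝 (dist (e x) (e x') - dist x x')) := ((he x).dist (he x')).sub_const _
    have t2 : Tendsto (fun n => dist (u n x) (u n x') - dist x x') (hyperfilter ℕ) (𝓝 0) :=
      squeeze_zero_norm (fun n => hgf n x x') (by simpa using hr'.const_mul 2)
    exact sub_eq_zero.1 (tendsto_nhds_unique t1 t2)
  -- A preimage of `y` is the limit of its approximate partners `v n y`.
  have e_surj : Function.Surjective e := by
    intro y
    obtain ⟨x, hx⟩ := lim fun n => v n y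
    refine ⟨x, tendsto_nhds_unique (he x) ?_⟩
    rw [tendsto_iff_dist_tendsto_zero] at hx ⊢
    refine squeeze_zero (fun _ => dist_nonneg) (fun n => ?_)
      (by simpa using (hr'.add hx).add hr')
    rw [← (hg n).dist_eq, ← (hf n).dist_eq]
    refine (dist_triangle4 _ (f n x) (f n (v n y)) _).trans ?_
    rw [dist_comm _ (f n x), dist_comm (f n x) (f n _)]
    linarith [hu n x, hv n y]
  have hcont : ∀ n, Continuous fun x => dist (f n x) (g n (e x)) := fun n =>
    (hf n).continuous.dist ((hg n).continuous.comp e_isom.continuous)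
  -- The uniform error `c n` is attained at a point `m n`. Convergence at the limit of the points `m
  -- n`, together with the isometry property, then makes pointwise convergence uniform.
  have hmax : ∀ n, ∃ x, ∀ x', dist (f n x') (g n (e x')) ≤ dist (f n x) (g n (e x)) := fun n => by
    obtain ⟨x, -, hx⟩ := isCompact_univ.exists_isMaxOn univ_nonempty (hcont n).continuousOn
    exact ⟨x, fun x' => hx (mem_univ x')⟩
  choose m hm using hmax
  refine ⟨⟨Equiv.ofBijective e ⟨e_isom.injective, e_surj⟩, e_isom⟩,
    fun n => dist (f n (m n)) (g n (e (m n))), hm, ?_⟩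
  obtain ⟨x, hx⟩ := lim m
  have hx' := (tendsto_iff_dist_tendsto_zero.1 hx).const_mul 2
  have hex := tendsto_iff_dist_tendsto_zero.1 (he x)
  refine squeeze_zero (fun _ => dist_nonneg) (fun n => ?_) (by simpa using (hx'.add hr').add hex)
  have a1 := dist_triangle4 (f n (m n)) (f n x) (g n (u n x)) (g n (e (m n)))
  have a2 := dist_triangle (u n x) (e x) (e (m n))
  rw [(hf n).dist_eq, (hg n).dist_eq] at a1
  rw [dist_comm (e x), e_isom.dist_eq] at a2
  linarith [hu n x]

/-- The limiting isometry `e` makes `f n` and `g n ∘ e` uniformly close, and regularity turns this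
into closeness of the transported structures; thus `e` maps one structure exactly to the other. -/
theorem eq_of_ghfDist_eq_zero (hτ : τ.IsRegular) {p q : CSpace τ} (h : ghfDist τ p q = 0) :
    p = q := by
  obtain ⟨P, rfl⟩ := Quotient.exists_rep p
  obtain ⟨Q, rfl⟩ := Quotient.exists_rep q
  have h' : ∀ n : ℕ, P.Near Q (1 / ((n : ℝ) + 1)) := fun n => by
    rw [← ghfDist_lt_iff, h]; positivity
  choose Z f g hf hg h1 h2 using h'
  obtain ⟨e, c, hc, hc0⟩ := exists_isometryEquiv_of_hausdorffDist_lt Z f g hf hg _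
    tendsto_one_div_add_atTop_nhds_zero_nat h1
  refine Quotient.sound ⟨e, dist_le_zero.1 ?_⟩
  have lim : Tendsto (fun n : ℕ => c n + 1 / ((n : ℝ) + 1)) (hyperfilter ℕ) (𝓝 0) := by
    simpa using hc0.add ((tendsto_one_div_add_atTop_nhds_zero_nat (𝕜 := ℝ)).mono_left
      Nat.hyperfilter_le_atTop)
  refine ge_of_tendsto' lim fun n => ?_
  rw [← (τ.isometry_map _ (hg n)).dist_eq, ← τ.map_comp e (g n) e.isometry (hg n)]
  refine (dist_triangle_left _ _ (τ.map (f n) (hf n) P.str)).trans (add_le_add ?_ (h2 n).le)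
  exact hτ.dist_map_le _ _ _ _ _ _ (hc n)

/-- The Gromov–Hausdorff-functor metric. -/
@[reducible] def CompFunctor.IsRegular.metricSpace (hτ : τ.IsRegular) :
    MetricSpace (CSpace τ) where
  dist := ghfDist τ
  dist_self := ghfDist_self
  dist_comm := ghfDist_comm
  dist_triangle := ghfDist_triangle
  eq_of_dist_eq_zero := eq_of_ghfDist_eq_zero hτ

end

section

/-! ### Completeness -/

/-- A metric space into which `A` is embedded. -/
structure MetricExtension (A : CompObj.{u}) : Type (u + 1) where
  carrier : Type u
  [metric : MetricSpace carrier]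
  embed : A → carrier
  isometry_embed : Isometry embed

attribute [instance] MetricExtension.metric

/-- The spaces `Z 0`, …, `Z (n - 1)` glued successively along `X 1`, …, `X (n - 1)`. -/
def successiveGluing {X Z : ℕ → CompObj.{u}} {f : ∀ n, X n → Z n} {g : ∀ n, X (n + 1) → Z n}
    (hf : ∀ n, Isometry (f n)) (hg : ∀ n, Isometry (g n)) : ∀ n, MetricExtension (X n)
  | 0 => ⟨X 0, id, isometry_id⟩
  | n + 1 =>
    let Y := successiveGluing hf hg n
    ⟨GlueSpace Y.isometry_embed (hf n), toGlueR Y.isometry_embed (hf n) ∘ g n,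
      (toGlueR_isometry _ _).comp (hg n)⟩

/-- A sequence of couplings of consecutive spaces is realized in one complete space. -/
theorem exists_simultaneous_embedding {X Z : ℕ → CompObj.{u}} {f : ∀ n, X n → Z n}
    {g : ∀ n, X (n + 1) → Z n} (hf : ∀ n, Isometry (f n)) (hg : ∀ n, Isometry (g n)) :
    ∃ (W : Type u) (_ : MetricSpace W) (_ : CompleteSpace W) (j : ∀ n, X n → W),
      (∀ n, Isometry (j n)) ∧
        ∀ n x y, dist (j n x) (j (n + 1) y) = dist (f n x) (g n y) := by
  let Y := successiveGluing hf hg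
  let l : ∀ n, (Y n).carrier → (Y (n + 1)).carrier := fun n =>
    toGlueL (Y n).isometry_embed (hf n)
  have hl : ∀ n, Isometry (l n) := fun n => toGlueL_isometry _ _
  let m : ∀ n, Z n → (Y (n + 1)).carrier := fun n => toGlueR (Y n).isometry_embed (hf n)
  have hm : ∀ n, Isometry (m n) := fun n => toGlueR_isometry _ _
  have hlm : ∀ n x, l n ((Y n).embed x) = m n (f n x) := fun n x =>
    congrFun (toGlue_commute (Y n).isometry_embed (hf n)) x
  have hmg : ∀ n y, (Y (n + 1)).embed y = m n (g n y) := fun _ _ => rfl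
  -- The inductive limit of the successive gluings contains all the spaces; its completion is the
  -- required ambient space.
  let k : ∀ n, (Y n).carrier → UniformSpace.Completion (InductiveLimit hl) := fun n y =>
    (toInductiveLimit hl n y : UniformSpace.Completion (InductiveLimit hl))
  have hk : ∀ n, Isometry (k n) := fun n =>
    UniformSpace.Completion.coe_isometry.comp (toInductiveLimit_isometry hl n)
  have hkl : ∀ n y, k (n + 1) (l n y) = k n y := fun n y =>
    congrArg (fun z : InductiveLimit hl => (z : UniformSpace.Completion (InductiveLimit hl)))
      (congrFun (toInductiveLimit_commute hl n) y)
  refine ⟨_, _, inferInstance, fun n => k n ∘ (Y n).embed,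
    fun n => (hk n).comp (Y n).isometry_embed, fun n x y => ?_⟩
  simp only [Function.comp_apply]
  rw [← hkl, hlm, hmg, (hk _).dist_eq, (hm n).dist_eq]

/-- The metric on the union of the two images is determined by the cross distances. This allows
estimates to be moved from one coupling to another. -/
theorem exists_isometry_of_dist_eq {X Y Z W : Type*} [MetricSpace X] [MetricSpace Y]
    [MetricSpace Z] [MetricSpace W] {f : X → Z} {g : Y → Z} {f' : X → W} {g' : Y → W}
    (hf : Isometry f) (hg : Isometry g) (hf' : Isometry f') (hg' : Isometry g')
    (h : ∀ x y, dist (f x) (g y) = dist (f' x) (g' y)) :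
    ∃ k : ↥(range f ∪ range g) → W, Isometry k ∧ (∀ x, k ⟨f x, Or.inl ⟨x, rfl⟩⟩ = f' x) ∧
      ∀ y, k ⟨g y, Or.inr ⟨y, rfl⟩⟩ = g' y := by
  have key : ∀ a b : X ⊕ Y, dist (Sum.elim f' g' a) (Sum.elim f' g' b) =
      dist (Sum.elim f g a) (Sum.elim f g b) := by
    rintro (x | y) (x' | y') <;>
      simp only [Sum.elim_inl, Sum.elim_inr, hf.dist_eq, hg.dist_eq, hf'.dist_eq, hg'.dist_eq, h]
    rw [dist_comm, ← h, dist_comm]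
  have hs : ∀ z : ↥(range f ∪ range g), ∃ a : X ⊕ Y, Sum.elim f g a = z := by
    rintro ⟨_, ⟨x, rfl⟩ | ⟨y, rfl⟩⟩
    exacts [⟨Sum.inl x, rfl⟩, ⟨Sum.inr y, rfl⟩]
  choose s hs using hs
  refine ⟨fun z => Sum.elim f' g' (s z), Isometry.of_dist_eq fun z z' => ?_, fun x => ?_,
    fun y => ?_⟩
  · rw [key, hs, hs]; rfl
  · rw [← dist_eq_zero]
    exact (key _ (Sum.inl x)).trans (by rw [hs]; exact dist_self _)
  · rw [← dist_eq_zero]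
    exact (key _ (Sum.inr y)).trans (by rw [hs]; exact dist_self _)

theorem hausdorffDist_range_eq_of_dist_eq {X Y Z W : Type*} [MetricSpace X] [MetricSpace Y]
    [MetricSpace Z] [MetricSpace W] {f : X → Z} {g : Y → Z} {f' : X → W} {g' : Y → W}
    (hf : Isometry f) (hg : Isometry g) (hf' : Isometry f') (hg' : Isometry g')
    (h : ∀ x y, dist (f x) (g y) = dist (f' x) (g' y)) :
    hausdorffDist (range f) (range g) = hausdorffDist (range f') (range g') := by
  obtain ⟨k, hk, hkf, hkg⟩ := exists_isometry_of_dist_eq hf hg hf' hg' h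
  rw [← funext hkf, ← funext hkg, range_comp' k, range_comp' k, hausdorffDist_image hk,
    ← hausdorffDist_image (isometry_subtype_coe (s := range f ∪ range g)), ← range_comp,
    ← range_comp]
  rfl

variable {τ : CompFunctor.{u, w}}

/-- Both couplings factor through the compact union of the two images in `Z`, and the functor turns
the embeddings of this union into isometries. -/
theorem CompFunctor.dist_map_eq_of_dist_eq {X Y Z W : CompObj.{u}}
    {f : X → Z} {g : Y → Z} {f' : X → W} {g' : Y → W}
    (hf : Isometry f) (hg : Isometry g) (hf' : Isometry f') (hg' : Isometry g')
    (h : ∀ x y, dist (f x) (g y) = dist (f' x) (g' y)) (a : τ.obj X) (b : τ.obj Y) :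
    dist (τ.map f hf a) (τ.map g hg b) = dist (τ.map f' hf' a) (τ.map g' hg' b) := by
  obtain ⟨k, hk, hkf, hkg⟩ := exists_isometry_of_dist_eq hf hg hf' hg' h
  have hc : CompactSpace ↥(range f ∪ range g) := isCompact_iff_compactSpace.1
    ((isCompact_range hf.continuous).union (isCompact_range hg.continuous))
  have hn : Nonempty ↥(range f ∪ range g) := ((range_nonempty f).inl).to_subtype
  let V : CompObj.{u} := ⟨↥(range f ∪ range g)⟩
  let f₀ : X → V := fun x => ⟨f x, Or.inl ⟨x, rfl⟩⟩
  let g₀ : Y → V := fun y => ⟨g y, Or.inr ⟨y, rfl⟩⟩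
  let ι : V → Z := Subtype.val
  have hι : Isometry ι := isometry_subtype_coe
  have hf₀ : Isometry f₀ := hf
  have hg₀ : Isometry g₀ := hg
  let k' : V → W := k
  have hk' : Isometry k' := hk
  rw [τ.map_congr (show f' = k' ∘ f₀ from (funext hkf).symm) hf' (hk'.comp hf₀),
    τ.map_congr (show g' = k' ∘ g₀ from (funext hkg).symm) hg' (hk'.comp hg₀),
    τ.map_comp f₀ k' hf₀ hk', τ.map_comp g₀ k' hg₀ hk', (τ.isometry_map _ hk').dist_eq,
    ← (τ.isometry_map ι hι).dist_eq, ← τ.map_comp f₀ ι hf₀ hι, ← τ.map_comp g₀ ι hg₀ hι]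
  rfl

/-- It suffices to treat sequences with geometrically decreasing steps. In a common complete space
their images converge in the Hausdorff metric to a compact set `L`, and the limit of the structures
descends to `L` by regularity. -/
theorem CompFunctor.IsRegular.completeSpace (hτ : τ.IsRegular) :
    @CompleteSpace (CSpace τ) hτ.metricSpace.toUniformSpace := by
  let _ := hτ.metricSpace
  refine complete_of_convergent_controlled_sequences (fun n => (1 / 2 : ℝ) ^ n)
    (fun n => by positivity) fun p hp => ?_
  choose P hP using fun n => Quotient.exists_rep (p n)
  have hP' : ∀ n, (P n).Near (P (n + 1)) ((1 / 2 : ℝ) ^ n) := fun n => by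
    rw [← ghfDist_lt_iff, hP, hP]
    exact hp n n (n + 1) le_rfl n.le_succ
  choose Z f g hf hg h1 h2 using hP'
  obtain ⟨W, _, _, j, hj, hjd⟩ := exists_simultaneous_embedding hf hg
  let K : ℕ → NonemptyCompacts W := fun n =>
    ⟨⟨range (j n), isCompact_range (hj n).continuous⟩, range_nonempty _⟩
  have hK : CauchySeq K := by
    refine cauchySeq_of_le_geometric (1 / 2) 1 (by norm_num) fun n => ?_
    rw [one_mul, NonemptyCompacts.dist_eq]
    refine le_trans (le_of_eq ?_) (h1 n).le
    exact (hausdorffDist_range_eq_of_dist_eq (hf n) (hg n) (hj n) (hj (n + 1))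
      fun x y => (hjd n x y).symm).symm
  obtain ⟨L, hL⟩ := cauchySeq_tendsto_of_complete hK
  -- `W` need not be compact, so the functor cannot be applied to it. A convergent sequence of
  -- compact sets together with its limit has compact union, and `S` serves as the ambient space.
  let S : Set W := ⋃ K' ∈ insert L (range K), (K' : Set W)
  have hS : IsCompact S := NonemptyCompacts.isCompact_biUnion_coe_of_isCompact
    hL.isCompact_insert_range
  have hLS : (L : Set W) ⊆ S :=
    subset_biUnion_of_mem (u := fun K' : NonemptyCompacts W => (K' : Set W)) (mem_insert _ _)
  have hjS : ∀ n x, j n x ∈ S := fun n x =>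
    subset_biUnion_of_mem (u := fun K' : NonemptyCompacts W => (K' : Set W))
      (mem_insert_of_mem _ (mem_range_self n)) (mem_range_self x)
  have : CompactSpace S := isCompact_iff_compactSpace.1 hS
  have : Nonempty S := (L.nonempty.mono hLS).to_subtype
  have : CompactSpace (L : Set W) := isCompact_iff_compactSpace.1 L.isCompact
  have : Nonempty (L : Set W) := L.nonempty.to_subtype
  let S' : CompObj.{u} := ⟨S⟩
  let L' : CompObj.{u} := ⟨(L : Set W)⟩
  let i : ∀ n, (P n).space → S' := fun n x => ⟨j n x, hjS n x⟩
  have hi : ∀ n, Isometry (i n) := hj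
  let ι : L' → S' := inclusion hLS
  have hι : Isometry ι := fun _ _ => rfl
  let coe : S' → W := Subtype.val
  have hcoe : Isometry coe := isometry_subtype_coe
  have hLι : Tendsto (fun n => hausdorffDist (range (i n)) (range ι)) atTop (𝓝 0) := by
    rw [tendsto_iff_dist_tendsto_zero] at hL
    refine hL.congr fun n => ?_
    rw [NonemptyCompacts.dist_eq, ← hausdorffDist_image hcoe, ← range_comp, ← range_comp]
    congr
    exact Subtype.range_coe.symm
  have := hτ.complete S'
  have hα : CauchySeq fun n => τ.map (i n) (hi n) (P n).str := by
    refine cauchySeq_of_le_geometric (1 / 2) 1 (by norm_num) fun n => ?_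
    rw [one_mul]
    refine le_trans (le_of_eq ?_) (h2 n).le
    exact τ.dist_map_eq_of_dist_eq _ _ _ _ (fun x y => hjd n x y) _ _
  obtain ⟨α, hα⟩ := cauchySeq_tendsto_of_complete hα
  obtain ⟨c, hc⟩ := hτ.exists_map_eq_of_tendsto _ i hi ι hι hLι _ α hα
  refine ⟨⟦⟨L', c⟩⟧, Metric.tendsto_atTop'.2 fun ε hε => ?_⟩
  have e1 := hLι.eventually_lt_const hε
  have e2 := (tendsto_iff_dist_tendsto_zero.1 hα).eventually_lt_const hε
  obtain ⟨N, hN⟩ := eventually_atTop.1 (e1.and e2)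
  refine ⟨N, fun n hn => ?_⟩
  rw [← hP n]
  exact (ghfDist_lt_iff _ _ _).2 ⟨S', i n, ι, hi n, hι, (hN n hn.le).1, by
    rw [hc]; exact (hN n hn.le).2⟩

/-! ### Separability -/

theorem exists_finite_net (X : CompObj.{u}) {ε : ℝ} (hε : 0 < ε) :
    ∃ (n : ℕ) (s : Fin n → X), ∀ x, ∃ i, dist x (s i) < ε := by
  obtain ⟨t, -, ht, hc⟩ := finite_cover_balls_of_compact (isCompact_univ (X := X)) hε
  have := ht.fintype
  refine ⟨_, fun i => ((Fintype.equivFin t).symm i : X), fun x => ?_⟩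
  obtain ⟨y, hy, hxy⟩ := mem_iUnion₂.1 (hc (mem_univ x))
  exact ⟨Fintype.equivFin t ⟨y, hy⟩, by simpa using hxy⟩

theorem CompFunctor.IsRegular.separableSpace (hτ : τ.IsRegular) :
    @SeparableSpace (CSpace τ) hτ.metricSpace.toUniformSpace.toTopologicalSpace := by
  let _ := hτ.metricSpace
  suffices SecondCountableTopology (CSpace τ) from inferInstance
  refine secondCountable_of_countable_discretization fun δ hδ => ?_
  -- With nets of mesh `ε` glued at distance `ε`, the spaces are within `2 * ε` and the structures
  -- within `3 * ε`; the factor 4 makes both bounds strict.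
  obtain ⟨ε, hε, rfl⟩ : ∃ ε, 0 < ε ∧ δ = 4 * ε := ⟨δ / 4, by positivity, by ring⟩
  obtain ⟨code, hcode⟩ := hτ.exists_code ε hε
  choose P hP using fun p : CSpace τ => Quotient.exists_rep p
  choose n s hs using fun p => exists_finite_net (P p).space hε
  refine ⟨(Σ n : ℕ, Fin n → Fin n → ℤ) × ℕ, Encodable.ofCountable _, fun p =>
    (⟨n p, fun i j => ⌊dist (s p i) (s p j) / ε⌋⟩, code _ _ (s p) (P p).str), fun p q hpq => ?_⟩
  rw [Prod.mk.injEq, Sigma.mk.injEq] at hpq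
  obtain ⟨⟨hn, hd⟩, hc⟩ := hpq
  have hsp := hs p
  -- The nets are indexed by `Fin (n p)` and `Fin (n q)`; the sizes must be generalized and
  -- identified before the distance matrices can be compared.
  have hsq := hs q
  generalize s p = sp at *
  generalize s q = sq at *
  generalize n p = np at *
  subst hn
  rw [heq_eq_eq] at hd
  obtain ⟨i₀, -⟩ := hsp (Classical.arbitrary _)
  have : Nonempty (Fin (n q)) := ⟨i₀⟩
  have hdist : ∀ i j, |dist (sp i) (sp j) - dist (sq i) (sq j)| ≤ 2 * ε := fun i j => by
    have := (Int.abs_sub_lt_one_of_floor_eq_floor (congrFun (congrFun hd i) j)).le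
    rw [← sub_div, abs_div, abs_of_pos hε, div_le_one hε] at this
    linarith
  obtain ⟨Z, f, g, hf, hg, hfg⟩ := exists_gluing_of_distortion_le sp sq hε hdist
  change ghfDist τ p q ≤ _
  rw [← hP p, ← hP q]
  refine ((ghfDist_lt_iff _ _ _).2 ⟨Z, f, g, hf, hg, ?_, ?_⟩).le
  · refine lt_of_le_of_lt (b := 2 * ε) (hausdorffDist_le_of_mem_dist (by positivity) ?_ ?_)
      (by linarith)
    · rintro _ ⟨x, rfl⟩
      obtain ⟨i, hi⟩ := hsp x
      refine ⟨_, mem_range_self (sq i), (dist_triangle _ (f (sp i)) _).trans ?_⟩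
      rw [hf.dist_eq, hfg]; linarith
    · rintro _ ⟨y, rfl⟩
      obtain ⟨i, hi⟩ := hsq y
      refine ⟨_, mem_range_self (sp i), (dist_triangle _ (g (sq i)) _).trans ?_⟩
      rw [hg.dist_eq, dist_comm (g _), hfg]; linarith
  · refine lt_of_le_of_lt (hcode sp sq hsp hsq _ _ hc f g hf hg fun i => (hfg i).le) ?_
    linarith

end

section

/-! ### Regularity of the functors of points, marked compact subsets, and pairs -/

theorem exists_dist_lt_of_dist_nonemptyCompacts_lt {α : Type*} [MetricSpace α]
    {K L : NonemptyCompacts α} {r : ℝ} (h : dist K L < r) {x : α} (hx : x ∈ K) :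
    ∃ y ∈ L, dist x y < r :=
  exists_dist_lt_of_hausdorffDist_lt hx (by rwa [NonemptyCompacts.dist_eq] at h)
    (edist_ne_top K L)

theorem dist_nonemptyCompacts_le {α : Type*} [MetricSpace α] {K L : NonemptyCompacts α} {r : ℝ}
    (hr : 0 ≤ r) (h : ∀ x ∈ K, ∃ y ∈ L, dist x y ≤ r) (h' : ∀ y ∈ L, ∃ x ∈ K, dist y x ≤ r) :
    dist K L ≤ r := by
  rw [NonemptyCompacts.dist_eq]
  exact hausdorffDist_le_of_mem_dist hr h h'

theorem mem_range_of_tendsto {X : CompObj.{u}} {Z : Type*} [MetricSpace Z] {Y : ℕ → CompObj.{u}}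
    {f : ∀ n, Y n → Z} (hf : ∀ n, Isometry (f n)) {g : X → Z} (hg : Isometry g)
    (h : Tendsto (fun n => hausdorffDist (range (f n)) (range g)) atTop (𝓝 0)) {y : ∀ n, Y n}
    {z : Z} (hy : Tendsto (fun n => f n (y n)) atTop (𝓝 z)) : z ∈ range g := by
  rw [← (isCompact_range hg.continuous).isClosed.closure_eq, Metric.mem_closure_iff]
  intro ε hε
  obtain ⟨n, h1, h2⟩ := ((h.eventually_lt_const (half_pos hε)).and
    ((tendsto_iff_dist_tendsto_zero.1 hy).eventually_lt_const (half_pos hε))).exists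
  obtain ⟨w, hw, hd⟩ := exists_dist_lt_of_hausdorffDist_lt (mem_range_self (y n)) h1
    (hausdorffEDist_range_ne_top (hf n) hg)
  refine ⟨w, hw, ?_⟩
  linarith [dist_triangle_left z w (f n (y n))]

theorem pointFunctor_isRegular : pointFunctor.{u}.IsRegular where
  dist_map_le f g _ _ a r h := h a
  complete X := inferInstanceAs (CompleteSpace X)
  exists_map_eq_of_tendsto Y f hf g hg h b a ha := mem_range_of_tendsto hf hg h ha
  exists_code ε hε := by
    let A : ∀ (X : CompObj.{u}) (n : ℕ), (Fin n → X) → X → Set ℕ := fun X n s x =>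
      {i | ∃ h : i < n, dist x (s ⟨i, h⟩) < ε}
    -- A point is coded by the least index of a net point within `ε`. The set of indices is nonempty
    -- by the net property, so the default value of `sInf` does not occur.
    refine ⟨fun X n s x => sInf (A X n s x), ?_⟩
    intro X Y Z n s t hs ht (a : X) (b : Y) hab f g hf hg hfg
    have hab : sInf (A X n s a) = sInf (A Y n t b) := hab
    have h1 : sInf (A X n s a) ∈ A X n s a := by
      obtain ⟨i, hi⟩ := hs a
      exact Nat.sInf_mem ⟨i, i.2, hi⟩
    have h2 : sInf (A X n s a) ∈ A Y n t b := by
      rw [hab]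
      obtain ⟨i, hi⟩ := ht b
      exact Nat.sInf_mem ⟨i, i.2, hi⟩
    obtain ⟨h, h1⟩ := h1
    obtain ⟨_, h2⟩ := h2
    change dist (f a) (g b) ≤ _
    refine (dist_triangle4 _ (f (s ⟨_, h⟩)) (g (t ⟨_, h⟩)) _).trans ?_
    rw [hf.dist_eq, hg.dist_eq, dist_comm _ b]
    linarith [hfg ⟨_, h⟩]

theorem prodFunctor_isRegular {τ₁ : CompFunctor.{u, v}} {τ₂ : CompFunctor.{u, w}}
    (h₁ : τ₁.IsRegular) (h₂ : τ₂.IsRegular) : (prodFunctor τ₁ τ₂).IsRegular where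
  dist_map_le f g hf hg a r h :=
    max_le (h₁.dist_map_le f g hf hg a.1 r h) (h₂.dist_map_le f g hf hg a.2 r h)
  complete X := by
    have := h₁.complete X
    have := h₂.complete X
    exact inferInstanceAs (CompleteSpace (τ₁.obj X × τ₂.obj X))
  exists_map_eq_of_tendsto Y f hf g hg h b a ha := by
    obtain ⟨c₁, hc₁⟩ := h₁.exists_map_eq_of_tendsto Y f hf g hg h (fun n => (b n).1) a.1
      ((continuous_fst.tendsto a).comp ha)
    obtain ⟨c₂, hc₂⟩ := h₂.exists_map_eq_of_tendsto Y f hf g hg h (fun n => (b n).2) a.2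
      ((continuous_snd.tendsto a).comp ha)
    exact ⟨(c₁, c₂), Prod.ext hc₁ hc₂⟩
  exists_code ε hε := by
    obtain ⟨code₁, hcode₁⟩ := h₁.exists_code ε hε
    obtain ⟨code₂, hcode₂⟩ := h₂.exists_code ε hε
    refine ⟨fun X n s a => Nat.pair (code₁ X n s a.1) (code₂ X n s a.2), ?_⟩
    intro X Y Z n s t hs ht a b hab f g hf hg hfg
    rw [Nat.pair_eq_pair] at hab
    exact max_le (hcode₁ s t hs ht _ _ hab.1 f g hf hg hfg)
      (hcode₂ s t hs ht _ _ hab.2 f g hf hg hfg)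

theorem dist_markedFunctor_map_le {Ξ : Type v} [MetricSpace Ξ] {X Y Z : CompObj.{u}} {f : X → Z}
    {g : Y → Z} {hf : Isometry f} {hg : Isometry g} {K : NonemptyCompacts (X × Ξ)}
    {L : NonemptyCompacts (Y × Ξ)} {r : ℝ} (hr : 0 ≤ r)
    (h : ∀ p ∈ K, ∃ q ∈ L, dist (f p.1) (g q.1) ≤ r ∧ dist p.2 q.2 ≤ r)
    (h' : ∀ q ∈ L, ∃ p ∈ K, dist (f p.1) (g q.1) ≤ r ∧ dist p.2 q.2 ≤ r) :
    dist ((markedFunctor.{u, v} Ξ).map f hf K) ((markedFunctor.{u, v} Ξ).map g hg L) ≤ r := by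
  refine dist_nonemptyCompacts_le (α := Z × Ξ) hr ?_ ?_
  · rintro _ ⟨p, hp, rfl⟩
    obtain ⟨q, hq, h1, h2⟩ := h p hp
    exact ⟨_, ⟨q, hq, rfl⟩, max_le h1 h2⟩
  · rintro _ ⟨q, hq, rfl⟩
    obtain ⟨p, hp, h1, h2⟩ := h' q hq
    exact ⟨_, ⟨p, hp, rfl⟩, max_le (by rwa [dist_comm]) (by rwa [dist_comm])⟩

theorem exists_dist_lt_of_dist_markedFunctor_map_lt {Ξ : Type v} [MetricSpace Ξ]
    {X Y Z : CompObj.{u}} {f : X → Z} {g : Y → Z} {hf : Isometry f} {hg : Isometry g}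
    {K : NonemptyCompacts (X × Ξ)} {L : NonemptyCompacts (Y × Ξ)} {r : ℝ}
    (h : dist ((markedFunctor.{u, v} Ξ).map f hf K) ((markedFunctor.{u, v} Ξ).map g hg L) < r)
    {p : X × Ξ} (hp : p ∈ K) : ∃ q ∈ L, dist (f p.1) (g q.1) < r ∧ dist p.2 q.2 < r := by
  obtain ⟨_, ⟨q, hq, rfl⟩, hd⟩ := exists_dist_lt_of_dist_nonemptyCompacts_lt (α := Z × Ξ) h
    (mem_image_of_mem (Prod.map f id) hp)
  exact ⟨q, hq, max_lt_iff.1 hd⟩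

/-- A compact marked set is described up to `ε` by a finite subset of a countable dense family. -/
theorem exists_finset_net {X Ξ D : Type*} [MetricSpace X] [MetricSpace Ξ] {ι : Type*}
    (K : NonemptyCompacts (X × Ξ)) (s : ι → X) (d : D → Ξ) (hd : DenseRange d) {ε : ℝ}
    (hε : 0 < ε) (hs : ∀ x, ∃ i, dist x (s i) < ε) :
    ∃ T : Finset (ι × D), (∀ p ∈ K, ∃ q ∈ T, dist p.1 (s q.1) < ε ∧ dist p.2 (d q.2) < ε) ∧
      ∀ q ∈ T, ∃ p ∈ K, dist p.1 (s q.1) < ε ∧ dist p.2 (d q.2) < ε := by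
  classical
  obtain ⟨T, hT⟩ := K.isCompact.elim_finite_subcover
    (fun q : ι × D => ball (s q.1, d q.2) ε) (fun _ => isOpen_ball) fun p _ => by
      obtain ⟨i, hi⟩ := hs p.1
      obtain ⟨k, hk⟩ := hd.exists_dist_lt p.2 hε
      exact mem_iUnion.2 ⟨(i, k), max_lt hi hk⟩
  -- Balls of the subcover that miss `K` are discarded, which gives the second property and
  -- preserves the first.
  refine ⟨T.filter fun q => ∃ p ∈ K, dist p.1 (s q.1) < ε ∧ dist p.2 (d q.2) < ε, ?_,
    fun q hq => (Finset.mem_filter.1 hq).2⟩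
  intro p hp
  obtain ⟨q, hq, hpq⟩ := mem_iUnion₂.1 (hT hp)
  have hpq := max_lt_iff.1 (mem_ball.1 hpq)
  exact ⟨q, Finset.mem_filter.2 ⟨hq, p, hp, hpq⟩, hpq⟩

/-- Limits stay over the limit subspace because its image is closed. The code of a marked set is a
finite set of pairs of a net point and a mark from a countable dense set. -/
theorem markedFunctor_isRegular (Ξ : Type v) [MetricSpace Ξ] [CompleteSpace Ξ]
    [SeparableSpace Ξ] : (markedFunctor.{u, v} Ξ).IsRegular where
  dist_map_le f g hf hg a r h := by
    have hr : 0 ≤ r := dist_nonneg.trans (h (Classical.arbitrary _))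
    exact dist_markedFunctor_map_le hr
      (fun p hp => ⟨p, hp, h _, by simpa⟩) (fun p hp => ⟨p, hp, h _, by simpa⟩)
  complete X := inferInstanceAs (CompleteSpace (NonemptyCompacts (X × Ξ)))
  exists_map_eq_of_tendsto {Z X} Y f hf g hg h b a hba := by
    have ha := tendsto_iff_dist_tendsto_zero.1 hba
    clear hba
    revert a
    intro (a : NonemptyCompacts (Z × Ξ)) ha
    -- Each point of the limit set is approximated by points over the ranges of `f n`, hence its
    -- first coordinate lies in the range of `g`. The preimage of `a` is then the required
    -- structure.
    have key : ∀ z ∈ a, z.1 ∈ range g := by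
      intro z hz
      have : ∀ n, ∃ p : Y n × Ξ, dist z.1 (f n p.1) <
          dist ((markedFunctor.{u, v} Ξ).map (f n) (hf n) (b n)) a + 1 / ((n : ℝ) + 1) := by
        intro n
        obtain ⟨_, ⟨p, -, rfl⟩, hd⟩ := exists_dist_lt_of_dist_nonemptyCompacts_lt
          (α := Z × Ξ) (r := dist ((markedFunctor.{u, v} Ξ).map (f n) (hf n) (b n)) a + 1 / ((n : ℝ) + 1))
          (by rw [dist_comm]; exact lt_add_of_pos_right _ (by positivity)) hz
        exact ⟨p, (max_lt_iff.1 hd).1⟩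
      choose p hd using this
      refine mem_range_of_tendsto (y := fun n => (p n).1) hf hg h ?_
      rw [tendsto_iff_dist_tendsto_zero]
      refine squeeze_zero (fun _ => dist_nonneg)
        (fun n => (dist_comm _ _).trans_le (hd n).le) ?_
      simpa using ha.add (tendsto_one_div_add_atTop_nhds_zero_nat (𝕜 := ℝ))
    have hG : Isometry (Prod.map g id : X × Ξ → Z × Ξ) := isometry_markMap Ξ g hg
    have hsub : (a : Set (Z × Ξ)) ⊆ range (Prod.map g id : X × Ξ → Z × Ξ) := by
      rintro ⟨z, ξ⟩ hz
      obtain ⟨x, hx⟩ := key _ hz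
      exact ⟨(x, ξ), Prod.ext hx rfl⟩
    refine ⟨(⟨⟨Prod.map g id ⁻¹' (a : Set (Z × Ξ)),
      hG.isClosedEmbedding.isCompact_preimage a.isCompact⟩, ?_⟩ : NonemptyCompacts (X × Ξ)),
      NonemptyCompacts.ext ?_⟩
    · obtain ⟨z, hz⟩ := a.nonempty
      obtain ⟨x, rfl⟩ := hsub hz
      exact ⟨x, hz⟩
    · exact image_preimage_eq_of_subset hsub
  exists_code ε hε := by
    obtain ⟨D, hDc, hD⟩ := exists_countable_dense Ξ
    have := hDc.to_subtype
    have hd : DenseRange ((↑) : D → Ξ) := hD.denseRange_val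
    let _ : ∀ n, Encodable (Finset (Fin n × D)) := fun n => Encodable.ofCountable _
    classical
    -- The default 0 is irrelevant, since codes are compared only for families that are `ε`-nets.
    refine ⟨fun X n s K => if hs : ∀ x, ∃ i, dist x (s i) < ε then
      Encodable.encode (exists_finset_net K s _ hd hε hs).choose else 0, ?_⟩
    intro X Y Z n s t hs ht K L hKL f g hf hg hfg
    simp only [dif_pos hs, dif_pos ht] at hKL
    have hKL := Encodable.encode_injective hKL
    obtain ⟨k1, k2⟩ := (exists_finset_net K s _ hd hε hs).choose_spec
    obtain ⟨l1, l2⟩ := (exists_finset_net L t _ hd hε ht).choose_spec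
    rw [← hKL] at l1 l2
    have key : ∀ (p : X × Ξ) (q : Y × Ξ) (c : Fin n × D), dist p.1 (s c.1) < ε ∧
        dist p.2 c.2 < ε → dist q.1 (t c.1) < ε ∧ dist q.2 c.2 < ε →
        dist (f p.1) (g q.1) ≤ 3 * ε ∧ dist p.2 q.2 ≤ 3 * ε := by
      rintro p q c ⟨h1, h2⟩ ⟨h3, h4⟩
      constructor
      · refine (dist_triangle4 _ (f (s c.1)) (g (t c.1)) _).trans ?_
        rw [hf.dist_eq, hg.dist_eq, dist_comm _ q.1]
        linarith [hfg c.1]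
      · linarith [dist_triangle_right p.2 q.2 c.2]
    refine dist_markedFunctor_map_le (by positivity) (fun p hp => ?_) (fun q hq => ?_)
    · obtain ⟨c, hc, h⟩ := k1 p hp
      obtain ⟨q, hq, h'⟩ := l2 c hc
      exact ⟨q, hq, key p q c h h'⟩
    · obtain ⟨c, hc, h⟩ := l1 q hq
      obtain ⟨p, hp, h'⟩ := k2 c hc
      exact ⟨p, hp, key p q c h' h⟩

theorem pointedMarkedFunctor_isRegular (Ξ : Type v) [MetricSpace Ξ] [CompleteSpace Ξ]
    [SeparableSpace Ξ] : (pointedMarkedFunctor.{u, v} Ξ).IsRegular :=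
  prodFunctor_isRegular pointFunctor_isRegular (markedFunctor_isRegular Ξ)

end

section

/-! ### Correspondences and couplings -/

theorem correspondenceCost_le {X Y Ξ : Type*} [MetricSpace X] [MetricSpace Y] [MetricSpace Ξ]
    {φ : X → Ξ} {ψ : Y → Ξ} {R : Set (X × Y)} {r : ℝ} (hr : 0 ≤ r)
    (h : ∀ p ∈ R, ∀ q ∈ R, |dist p.1 q.1 - dist p.2 q.2| ≤ 2 * r)
    (h' : ∀ p ∈ R, dist (φ p.1) (ψ p.2) ≤ r) : correspondenceCost φ ψ R ≤ r := by
  refine max_le ?_ (Real.sSup_le ?_ hr)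
  · have : distortion R ≤ 2 * r := by
      refine Real.sSup_le ?_ (by positivity)
      rintro _ ⟨p, hp, q, hq, rfl⟩
      exact h p hp q hq
    linarith
  · rintro _ ⟨p, hp, rfl⟩
    exact h' p hp

theorem correspondenceCost_nonneg {X Y Ξ : Type*} [MetricSpace X] [MetricSpace Y]
    [MetricSpace Ξ] (φ : X → Ξ) (ψ : Y → Ξ) (R : Set (X × Y)) :
    0 ≤ correspondenceCost φ ψ R := by
  refine le_max_of_le_right (Real.sSup_nonneg ?_)
  rintro _ ⟨p, -, rfl⟩
  exact dist_nonneg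

/-- Compactness bounds the set in `distortion`, so its `sSup` is a genuine supremum and not the
default 0. -/
theorem abs_dist_sub_dist_le_correspondenceCost {X Y Ξ : Type*} [MetricSpace X] [CompactSpace X]
    [MetricSpace Y] [CompactSpace Y] [MetricSpace Ξ] (φ : X → Ξ) (ψ : Y → Ξ) {R : Set (X × Y)}
    {p q : X × Y} (hp : p ∈ R) (hq : q ∈ R) :
    |dist p.1 q.1 - dist p.2 q.2| ≤ 2 * correspondenceCost φ ψ R := by
  have hb : BddAbove {r : ℝ | ∃ p ∈ R, ∃ q ∈ R, r = |dist p.1 q.1 - dist p.2 q.2|} := by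
    refine (isCompact_range (f := fun z : (X × Y) × (X × Y) =>
      |dist z.1.1 z.2.1 - dist z.1.2 z.2.2|) (by fun_prop)).bddAbove.mono ?_
    rintro _ ⟨p, -, q, -, rfl⟩
    exact ⟨(p, q), rfl⟩
  have h1 : |dist p.1 q.1 - dist p.2 q.2| ≤ distortion R := le_csSup hb ⟨p, hp, q, hq, rfl⟩
  have h2 : 1 / 2 * distortion R ≤ correspondenceCost φ ψ R := le_max_left _ _
  linarith

theorem dist_le_correspondenceCost {X Y Ξ : Type*} [MetricSpace X] [CompactSpace X]
    [MetricSpace Y] [CompactSpace Y] [MetricSpace Ξ] (φ : C(X, Ξ)) (ψ : C(Y, Ξ)) {R : Set (X × Y)}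
    {p : X × Y} (hp : p ∈ R) : dist (φ p.1) (ψ p.2) ≤ correspondenceCost φ ψ R := by
  refine le_max_of_le_right (le_csSup ?_ ⟨p, hp, rfl⟩)
  refine (isCompact_range (f := fun z : X × Y => dist (φ z.1) (ψ z.2))
    (by fun_prop)).bddAbove.mono ?_
  rintro _ ⟨p, -, rfl⟩
  exact ⟨p, rfl⟩

theorem isCorrespondence_iff {X Y : Type*} {R : Set (X × Y)} :
    IsCorrespondence R ↔ (∀ x, ∃ y, (x, y) ∈ R) ∧ ∀ y, ∃ x, (x, y) ∈ R := by
  simp [IsCorrespondence, eq_univ_iff_forall]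

theorem isCorrespondence_preimage {X Y X' Y' : Type*} {R : Set (X' × Y')}
    (hR : IsCorrespondence R) (e : X ≃ X') (e' : Y ≃ Y') :
    IsCorrespondence (Prod.map e e' ⁻¹' R) := by
  rw [isCorrespondence_iff] at hR ⊢
  refine ⟨fun x => ?_, fun y => ?_⟩
  · obtain ⟨y, hy⟩ := hR.1 (e x)
    exact ⟨e'.symm y, by simpa using hy⟩
  · obtain ⟨x, hx⟩ := hR.2 (e' y)
    exact ⟨e.symm x, by simpa using hx⟩

theorem correspondenceCost_preimage {X Y X' Y' : CompObj.{u}} {Ξ : Type v} [MetricSpace Ξ]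
    {φ : C(X, Ξ)} {ψ : C(Y, Ξ)} {φ' : C(X', Ξ)} {ψ' : C(Y', Ξ)} (e : X ≃ᵢ X') (e' : Y ≃ᵢ Y')
    (he : ∀ x, φ' (e x) = φ x) (he' : ∀ y, ψ' (e' y) = ψ y) (R : Set (X' × Y')) :
    correspondenceCost φ ψ (Prod.map e e' ⁻¹' R) ≤ correspondenceCost φ' ψ' R := by
  refine correspondenceCost_le (correspondenceCost_nonneg _ _ _) (fun p hp q hq => ?_)
    fun p hp => ?_
  · rw [← e.dist_eq, ← e'.dist_eq]
    exact abs_dist_sub_dist_le_correspondenceCost φ' ψ' hp hq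
  · rw [← he, ← he']
    exact dist_le_correspondenceCost φ' ψ' hp

variable {Ξ : Type v} [MetricSpace Ξ]

/-- Spaces in correspondence at cost less than `r` can be glued at distance less than `r`. -/
theorem exists_coupling_of_correspondenceCost_lt {X Y : CompObj.{u}} (φ : C(X, Ξ)) (ψ : C(Y, Ξ))
    {R : Set (X × Y)} (hR : IsCorrespondence R) {r : ℝ} (hr : correspondenceCost φ ψ R < r) :
    ∃ (Z : CompObj.{u}) (f : X → Z) (g : Y → Z) (hf : Isometry f) (hg : Isometry g),
      hausdorffDist (range f) (range g) < r ∧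
      dist ((markedFunctor.{u, v} Ξ).map f hf (graphCompact X φ))
        ((markedFunctor.{u, v} Ξ).map g hg (graphCompact Y ψ)) < r ∧
      ∀ p ∈ R, dist (f p.1) (g p.2) < r := by
  -- The gluing requires a positive distance even if the cost is 0, and the gap between `s` and `r`
  -- turns weak bounds into strict ones.
  obtain ⟨s, hs, hsr⟩ := exists_between hr
  have hs0 : 0 < s := (correspondenceCost_nonneg _ _ _).trans_lt hs
  obtain ⟨h1, h2⟩ := isCorrespondence_iff.1 hR
  have : Nonempty R := by
    obtain ⟨y, hy⟩ := h1 (Classical.arbitrary X)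
    exact ⟨⟨_, hy⟩⟩
  obtain ⟨Z, f, g, hf, hg, hfg⟩ := exists_gluing_of_distortion_le (fun p : R => p.1.1)
    (fun p : R => p.1.2) hs0 fun p q =>
      (abs_dist_sub_dist_le_correspondenceCost φ ψ p.2 q.2).trans (by linarith)
  have hd : ∀ p ∈ R, dist (φ p.1) (ψ p.2) ≤ s := fun p hp =>
    (dist_le_correspondenceCost φ ψ hp).trans hs.le
  refine ⟨Z, f, g, hf, hg, ?_, ?_, fun p hp => (hfg ⟨p, hp⟩).trans_lt hsr⟩
  · refine (hausdorffDist_le_of_mem_dist hs0.le ?_ ?_).trans_lt hsr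
    · rintro _ ⟨x, rfl⟩
      obtain ⟨y, hy⟩ := h1 x
      exact ⟨_, ⟨y, rfl⟩, (hfg ⟨_, hy⟩).le⟩
    · rintro _ ⟨y, rfl⟩
      obtain ⟨x, hx⟩ := h2 y
      exact ⟨_, ⟨x, rfl⟩, (dist_comm _ _).trans_le (hfg ⟨_, hx⟩).le⟩
  · refine (dist_markedFunctor_map_le hs0.le ?_ ?_).trans_lt hsr
    · rintro _ ⟨x, rfl⟩
      obtain ⟨y, hy⟩ := h1 x
      exact ⟨_, ⟨y, rfl⟩, (hfg ⟨_, hy⟩).le, hd _ hy⟩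
    · rintro _ ⟨y, rfl⟩
      obtain ⟨x, hx⟩ := h2 y
      exact ⟨_, ⟨x, rfl⟩, (hfg ⟨_, hx⟩).le, hd _ hx⟩

/-- The pairs of points at distance less than `r`, also with respect to the functions. -/
def closePairs {X Y Z : Type*} [MetricSpace Z] (f : X → Z) (g : Y → Z) (φ : X → Ξ) (ψ : Y → Ξ)
    (r : ℝ) : Set (X × Y) :=
  {p | dist (f p.1) (g p.2) < r ∧ dist (φ p.1) (ψ p.2) < r}

/-- Hausdorff closeness of the graphs in the max metric gives each graph point a partner that is
close in space and in mark simultaneously. -/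
theorem isCorrespondence_closePairs {X Y Z : CompObj.{u}} {f : X → Z} {g : Y → Z}
    {hf : Isometry f} {hg : Isometry g} {φ : C(X, Ξ)} {ψ : C(Y, Ξ)} {r : ℝ}
    (h : dist ((markedFunctor.{u, v} Ξ).map f hf (graphCompact X φ))
      ((markedFunctor.{u, v} Ξ).map g hg (graphCompact Y ψ)) < r) :
    IsCorrespondence (closePairs f g φ ψ r) := by
  refine isCorrespondence_iff.2 ⟨fun x => ?_, fun y => ?_⟩
  · obtain ⟨_, ⟨y, rfl⟩, h⟩ := exists_dist_lt_of_dist_markedFunctor_map_lt h (mem_range_self x)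
    exact ⟨y, h⟩
  · rw [dist_comm] at h
    obtain ⟨_, ⟨x, rfl⟩, h⟩ := exists_dist_lt_of_dist_markedFunctor_map_lt h (mem_range_self y)
    exact ⟨x, by rw [dist_comm]; exact h.1, by rw [dist_comm]; exact h.2⟩

theorem abs_dist_sub_dist_le_of_dist_lt {X Y Z : Type*} [MetricSpace X] [MetricSpace Y]
    [MetricSpace Z] {f : X → Z} {g : Y → Z} (hf : Isometry f) (hg : Isometry g) {r : ℝ}
    {p q : X × Y} (hp : dist (f p.1) (g p.2) < r) (hq : dist (f q.1) (g q.2) < r) :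
    |dist p.1 q.1 - dist p.2 q.2| ≤ 2 * r := by
  rw [← hf.dist_eq, ← hg.dist_eq, ← Real.dist_eq]
  exact (dist_dist_dist_le _ _ _ _).trans (by linarith)

/-! ### The space `𝒯` -/

theorem tDist_le_correspondenceCost (P Q : FunctionSpace.{u, v} Ξ)
    {R : Set (P.space × Q.space)} (hR : IsCorrespondence R) :
    tDist ⟦P⟧ ⟦Q⟧ ≤ correspondenceCost P.func Q.func R := by
  refine csInf_le ⟨0, ?_⟩ ⟨P, Q, rfl, rfl, R, hR, rfl⟩
  rintro _ ⟨_, _, _, _, _, _, rfl⟩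
  exact correspondenceCost_nonneg _ _ _

/-- A coupling yields the correspondence `closePairs`, and a correspondence yields a gluing. In the
first direction the Hausdorff distance of the spaces plays no role, since graphs project onto their
spaces. -/
theorem tDist_eq_ghfDist (p q : TSpace.{u, v} Ξ) :
    tDist p q = ghfDist _ (graphMap Ξ p) (graphMap Ξ q) := by
  obtain ⟨P, rfl⟩ := Quotient.exists_rep p
  obtain ⟨Q, rfl⟩ := Quotient.exists_rep q
  refine le_antisymm (le_of_forall_gt fun r hr => ?_) (le_of_forall_gt fun r hr => ?_)
  · obtain ⟨s, hs, hsr⟩ := exists_between hr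
    obtain ⟨Z, f, g, hf, hg, -, h⟩ := (ghfDist_lt_iff (τ := markedFunctor.{u, v} Ξ)
      ⟨P.space, graphCompact P.space P.func⟩
      ⟨Q.space, graphCompact Q.space Q.func⟩ s).1 hs
    refine (tDist_le_correspondenceCost P Q (isCorrespondence_closePairs h)).trans_lt
      (lt_of_le_of_lt ?_ hsr)
    exact correspondenceCost_le (dist_nonneg.trans h.le)
      (fun p hp q hq => abs_dist_sub_dist_le_of_dist_lt hf hg hp.1 hq.1) fun p hp => hp.2.le
  · obtain ⟨_, ⟨P', Q', hP, hQ, R, hR, rfl⟩, hc⟩ := exists_lt_of_csInf_lt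
      (by exact ⟨_, P, Q, rfl, rfl, univ, isCorrespondence_iff.2 (by simp), rfl⟩) hr
    obtain ⟨Z, f, g, hf, hg, h1, h2, -⟩ :=
      exists_coupling_of_correspondenceCost_lt P'.func Q'.func hR hc
    rw [← hP, ← hQ]
    exact (ghfDist_lt_iff (τ := markedFunctor.{u, v} Ξ)
      ⟨P'.space, graphCompact P'.space P'.func⟩
      ⟨Q'.space, graphCompact Q'.space Q'.func⟩ r).2 ⟨Z, f, g, hf, hg, h1, h2⟩

theorem apply_eq_of_map_graphCompact_eq {X Y : CompObj.{u}} {φ : C(X, Ξ)} {ψ : C(Y, Ξ)}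
    {e : X ≃ᵢ Y}
    (h : (markedFunctor.{u, v} Ξ).map e e.isometry (graphCompact X φ) = graphCompact Y ψ) (x : X) :
    ψ (e x) = φ x := by
  have hx : (e x, φ x) ∈ (graphCompact Y ψ : Set (Y × Ξ)) := by
    rw [← h]
    exact ⟨(x, φ x), mem_range_self x, rfl⟩
  obtain ⟨y, hy⟩ := hx
  rw [Prod.mk.injEq] at hy
  rw [← hy.2, hy.1]

variable (Ξ) in
theorem graphMap_injective : Function.Injective (graphMap.{u, v} Ξ) := by
  intro p q h
  obtain ⟨P, rfl⟩ := Quotient.exists_rep p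
  obtain ⟨Q, rfl⟩ := Quotient.exists_rep q
  obtain ⟨e, he⟩ : Structured.Equivalent _ _ := Quotient.exact h
  exact Quotient.sound ⟨e, apply_eq_of_map_graphCompact_eq he⟩

/-! ### The space `𝒯_*` -/

variable (Ξ) in
theorem pointedGraphMap_injective : Function.Injective (pointedGraphMap.{u, v} Ξ) := by
  intro p q h
  obtain ⟨P, rfl⟩ := Quotient.exists_rep p
  obtain ⟨Q, rfl⟩ := Quotient.exists_rep q
  obtain ⟨e, he⟩ : Structured.Equivalent _ _ := Quotient.exact h
  exact Quotient.sound ⟨e, congrArg Prod.fst he,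
    apply_eq_of_map_graphCompact_eq (congrArg Prod.snd he)⟩

theorem pointedTDist_le_correspondenceCost (P Q : PointedFunctionSpace.{u, v} Ξ)
    {R : Set (P.space × Q.space)} (hR : IsCorrespondence R) (ho : (P.root, Q.root) ∈ R) :
    pointedTDist ⟦P⟧ ⟦Q⟧ ≤ correspondenceCost P.func Q.func R := by
  refine csInf_le ⟨0, ?_⟩ ⟨P, Q, rfl, rfl, R, hR, ho, rfl⟩
  rintro _ ⟨_, _, _, _, _, _, _, rfl⟩
  exact correspondenceCost_nonneg _ _ _

/-- Correspondences are pulled back along isometries of representatives. Fixed representatives are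
needed to compose correspondences in the triangle inequality. -/
theorem pointedTDist_lt_iff (P Q : PointedFunctionSpace.{u, v} Ξ) (r : ℝ) :
    pointedTDist ⟦P⟧ ⟦Q⟧ < r ↔ ∃ R : Set (P.space × Q.space), IsCorrespondence R ∧
      (P.root, Q.root) ∈ R ∧ correspondenceCost P.func Q.func R < r := by
  constructor
  · intro h
    obtain ⟨_, ⟨P', Q', hP, hQ, R, hR, ho, rfl⟩, hc⟩ := exists_lt_of_csInf_lt
      (by exact ⟨_, P, Q, rfl, rfl, univ, isCorrespondence_iff.2 (by simp), mem_univ _, rfl⟩) h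
    obtain ⟨e, heo, he⟩ : PointedFunctionSpace.Equivalent P P' := Quotient.exact hP.symm
    obtain ⟨e', heo', he'⟩ : PointedFunctionSpace.Equivalent Q Q' := Quotient.exact hQ.symm
    refine ⟨Prod.map e e' ⁻¹' R, isCorrespondence_preimage hR e.toEquiv e'.toEquiv, ?_,
      (correspondenceCost_preimage e e' he he' R).trans_lt hc⟩
    rwa [mem_preimage, Prod.map_apply, heo, heo']
  · rintro ⟨R, hR, ho, hc⟩
    exact (pointedTDist_le_correspondenceCost P Q hR ho).trans_lt hc

theorem pointedTDist_nonneg (p q : PointedTSpace.{u, v} Ξ) : 0 ≤ pointedTDist p q := by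
  refine Real.sInf_nonneg ?_
  rintro _ ⟨_, _, _, _, _, _, _, rfl⟩
  exact correspondenceCost_nonneg _ _ _

theorem pointedTDist_self (p : PointedTSpace.{u, v} Ξ) : pointedTDist p p = 0 := by
  obtain ⟨P, rfl⟩ := Quotient.exists_rep p
  refine le_antisymm (le_of_forall_gt fun r hr => ?_) (pointedTDist_nonneg _ _)
  refine (pointedTDist_lt_iff _ _ _).2 ⟨{p | p.1 = p.2}, isCorrespondence_iff.2 (by simp), rfl,
    (correspondenceCost_le le_rfl ?_ ?_).trans_lt hr⟩
  · intro p (hp : p.1 = p.2) q (hq : q.1 = q.2)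
    simp [hp, hq]
  · intro p (hp : p.1 = p.2)
    simp [hp]

theorem pointedTDist_comm (p q : PointedTSpace.{u, v} Ξ) :
    pointedTDist p q = pointedTDist q p := by
  suffices ∀ p q : PointedTSpace.{u, v} Ξ, pointedTDist p q ≤ pointedTDist q p from
    le_antisymm (this p q) (this q p)
  intro p q
  obtain ⟨P, rfl⟩ := Quotient.exists_rep p
  obtain ⟨Q, rfl⟩ := Quotient.exists_rep q
  refine le_of_forall_gt fun r hr => ?_
  obtain ⟨R, hR, ho, hc⟩ := (pointedTDist_lt_iff _ _ _).1 hr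
  refine (pointedTDist_lt_iff _ _ _).2 ⟨Prod.swap ⁻¹' R,
    isCorrespondence_iff.2 (isCorrespondence_iff.1 hR).symm, ho,
    (correspondenceCost_le (correspondenceCost_nonneg Q.func P.func R) ?_ ?_).trans_lt hc⟩
  · intro p hp q hq
    rw [abs_sub_comm]
    exact abs_dist_sub_dist_le_correspondenceCost Q.func P.func (p := p.swap) (q := q.swap) hp hq
  · intro p hp
    rw [dist_comm]
    exact dist_le_correspondenceCost Q.func P.func (p := p.swap) hp

theorem pointedTDist_triangle (p q r : PointedTSpace.{u, v} Ξ) :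
    pointedTDist p r ≤ pointedTDist p q + pointedTDist q r := by
  obtain ⟨P, rfl⟩ := Quotient.exists_rep p
  obtain ⟨Q, rfl⟩ := Quotient.exists_rep q
  obtain ⟨S, rfl⟩ := Quotient.exists_rep r
  refine le_of_forall_pos_lt_add fun ε hε => ?_
  obtain ⟨R, hR, ho, hc⟩ := (pointedTDist_lt_iff P Q _).1 (lt_add_of_pos_right _ (half_pos hε))
  obtain ⟨R', hR', ho', hc'⟩ :=
    (pointedTDist_lt_iff Q S _).1 (lt_add_of_pos_right _ (half_pos hε))
  rw [isCorrespondence_iff] at hR hR'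
  refine (pointedTDist_lt_iff _ _ _).2 ⟨{p | ∃ y, (p.1, y) ∈ R ∧ (y, p.2) ∈ R'},
    isCorrespondence_iff.2 ⟨fun x => ?_, fun z => ?_⟩, ⟨_, ho, ho'⟩,
    (correspondenceCost_le (r := correspondenceCost P.func Q.func R +
      correspondenceCost Q.func S.func R') (add_nonneg (correspondenceCost_nonneg _ _ _)
      (correspondenceCost_nonneg _ _ _)) ?_ ?_).trans_lt (by linarith)⟩
  · obtain ⟨y, hy⟩ := hR.1 x
    obtain ⟨z, hz⟩ := hR'.1 y
    exact ⟨z, y, hy, hz⟩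
  · obtain ⟨y, hy⟩ := hR'.2 z
    obtain ⟨x, hx⟩ := hR.2 y
    exact ⟨x, y, hx, hy⟩
  · rintro p ⟨y, h1, h2⟩ q ⟨y', h1', h2'⟩
    have a1 := abs_dist_sub_dist_le_correspondenceCost P.func Q.func h1 h1'
    have a2 := abs_dist_sub_dist_le_correspondenceCost Q.func S.func h2 h2'
    refine (abs_sub_le _ (dist y y') _).trans ?_
    linarith
  · rintro p ⟨y, h1, h2⟩
    exact (dist_triangle _ (Q.func y) _).trans
      (add_le_add (dist_le_correspondenceCost _ _ h1) (dist_le_correspondenceCost _ _ h2))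

theorem ghfDist_pointedGraphMap_le (p q : PointedTSpace.{u, v} Ξ) :
    ghfDist _ (pointedGraphMap Ξ p) (pointedGraphMap Ξ q) ≤ pointedTDist p q := by
  obtain ⟨P, rfl⟩ := Quotient.exists_rep p
  obtain ⟨Q, rfl⟩ := Quotient.exists_rep q
  refine le_of_forall_gt fun r hr => ?_
  obtain ⟨R, hR, ho, hc⟩ := (pointedTDist_lt_iff _ _ _).1 hr
  obtain ⟨Z, f, g, hf, hg, h1, h2, h3⟩ :=
    exists_coupling_of_correspondenceCost_lt P.func Q.func hR hc
  exact (ghfDist_lt_iff (τ := pointedMarkedFunctor.{u, v} Ξ)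
    ⟨P.space, (P.root, graphCompact P.space P.func)⟩
    ⟨Q.space, (Q.root, graphCompact Q.space Q.func)⟩ r).2
    ⟨Z, f, g, hf, hg, h1, max_lt (h3 _ ho) h2⟩

/-- A coupling brings the roots close together but does not directly compare their marks. The
modulus of continuity of the function of `q` does, which is why `δ` depends on `q`. -/
theorem exists_pointedTDist_lt_of_ghfDist_lt (q : PointedTSpace.{u, v} Ξ) {ε : ℝ} (hε : 0 < ε) :
    ∃ δ > 0, ∀ p, ghfDist _ (pointedGraphMap Ξ p) (pointedGraphMap Ξ q) < δ →
      pointedTDist p q < ε := by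
  obtain ⟨Q, rfl⟩ := Quotient.exists_rep q
  obtain ⟨δ, hδ, hψ⟩ := Metric.uniformContinuous_iff.1
    (CompactSpace.uniformContinuous_of_continuous Q.func.continuous) (ε / 4) (by positivity)
  refine ⟨min (ε / 4) (δ / 2), by positivity, fun p hp => ?_⟩
  obtain ⟨P, rfl⟩ := Quotient.exists_rep p
  obtain ⟨Z, f, g, hf, hg, -, h⟩ := (ghfDist_lt_iff (τ := pointedMarkedFunctor.{u, v} Ξ)
    ⟨P.space, (P.root, graphCompact P.space P.func)⟩
    ⟨Q.space, (Q.root, graphCompact Q.space Q.func)⟩ _).1 hp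
  obtain ⟨ho, h⟩ := max_lt_iff.1 h
  change dist (f P.root) (g Q.root) < _ at ho
  set η := min (ε / 4) (δ / 2)
  have hη : η ≤ ε / 4 := min_le_left _ _
  have hη' : η ≤ δ / 2 := min_le_right _ _
  have hR := isCorrespondence_closePairs (hf := hf) (hg := hg) h
  -- A partner `y` of the first root is within `2 * η ≤ δ` of the second root. Its mark is therefore
  -- within `ε / 4` of the marks of both roots.
  have hroot : dist (P.func P.root) (Q.func Q.root) ≤ ε / 2 := by
    obtain ⟨y, hy, hy'⟩ := (isCorrespondence_iff.1 hR).1 P.root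
    have : dist y Q.root < δ := by
      rw [← hg.dist_eq]
      exact (dist_triangle_left _ _ (f P.root)).trans_lt (by linarith)
    exact (dist_triangle _ (Q.func y) _).trans (by linarith [hψ this])
  have hdist : ∀ p ∈ insert (P.root, Q.root) (closePairs f g P.func Q.func η),
      dist (f p.1) (g p.2) < η := by
    rintro p (rfl | hp)
    exacts [ho, hp.1]
  rw [isCorrespondence_iff] at hR
  refine (pointedTDist_lt_iff _ _ _).2 ⟨insert (P.root, Q.root) (closePairs f g P.func Q.func η),
    isCorrespondence_iff.2 ⟨fun x => (hR.1 x).imp fun _ => Or.inr,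
      fun y => (hR.2 y).imp fun _ => Or.inr⟩, mem_insert _ _,
    (correspondenceCost_le (half_pos hε).le ?_ ?_).trans_lt (half_lt_self hε)⟩
  · intro p hp q hq
    exact (abs_dist_sub_dist_le_of_dist_lt hf hg (hdist p hp) (hdist q hq)).trans (by linarith)
  · rintro p (rfl | hp)
    · exact hroot
    · exact hp.2.le.trans (by linarith)

end

section

variable (Ξ : Type v) [MetricSpace Ξ]

/-! ### The image of `𝒯` -/

/-- The projection of the marked set to the space is onto, and marks at points at distance less
than `δ` differ by at most `η`. -/
def HasModulus {X : CompObj.{u}} {Ξ : Type v} [MetricSpace Ξ] (K : NonemptyCompacts (X × Ξ))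
    (δ η : ℝ) : Prop :=
  (∀ x, ∃ ξ, (x, ξ) ∈ K) ∧ ∀ p ∈ K, ∀ q ∈ K, dist p.1 q.1 < δ → dist p.2 q.2 ≤ η

/-- The classes of spaces with marked sets that satisfy `HasModulus`. -/
def modulusSet (δ η : ℝ) : Set (CSpace (markedFunctor.{u, v} Ξ)) :=
  {c | ∃ P : Structured (markedFunctor.{u, v} Ξ), ⟦P⟧ = c ∧ HasModulus P.str δ η}

variable {Ξ}

/-- The condition survives limits because it combines a strict inequality in the hypothesis with a
weak one in the conclusion, and because projections of compact sets are closed. -/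
theorem hasModulus_of_near {P : Structured (markedFunctor.{u, v} Ξ)} {δ η : ℝ}
    (h : ∀ ε > 0, ∃ Q : Structured (markedFunctor.{u, v} Ξ), P.Near Q ε ∧ HasModulus Q.str δ η) :
    HasModulus P.str δ η := by
  obtain ⟨X, (K : NonemptyCompacts (X × Ξ))⟩ := P
  change HasModulus K δ η
  constructor
  · intro x
    suffices x ∈ Prod.fst '' (K : Set (X × Ξ)) by
      obtain ⟨p, hp, rfl⟩ := this
      exact ⟨p.2, hp⟩
    rw [← (K.isCompact.image continuous_fst).isClosed.closure_eq, Metric.mem_closure_iff]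
    intro ε hε
    obtain ⟨⟨Y, (L : NonemptyCompacts (Y × Ξ))⟩, ⟨Z, f, g, hf, hg, h1, h2⟩, hL, -⟩ :=
      h (ε / 2) (half_pos hε)
    obtain ⟨_, ⟨y, rfl⟩, hy⟩ := exists_dist_lt_of_hausdorffDist_lt (mem_range_self x) h1
      (hausdorffEDist_range_ne_top hf hg)
    obtain ⟨ξ, hξ⟩ := hL y
    rw [dist_comm] at h2
    obtain ⟨p, hp, hd, -⟩ := exists_dist_lt_of_dist_markedFunctor_map_lt h2 hξ
    refine ⟨p.1, ⟨p, hp, rfl⟩, ?_⟩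
    rw [← hf.dist_eq]
    exact (dist_triangle _ (g y) _).trans_lt (by linarith)
  · intro p hp q hq hpq
    refine le_of_forall_pos_le_add fun ε hε => ?_
    -- Passing to the partners changes the distance by less than `δ - dist p.1 q.1`, so it stays
    -- below `δ`, and changes the distance of the marks by less than `ε`.
    obtain ⟨⟨Y, (L : NonemptyCompacts (Y × Ξ))⟩, ⟨Z, f, g, hf, hg, -, h2⟩, -, hL⟩ :=
      h (min (ε / 2) ((δ - dist p.1 q.1) / 2)) (lt_min (half_pos hε) (by linarith))
    obtain ⟨p', hp', hd, hd'⟩ := exists_dist_lt_of_dist_markedFunctor_map_lt h2 hp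
    obtain ⟨q', hq', he, he'⟩ := exists_dist_lt_of_dist_markedFunctor_map_lt h2 hq
    rw [lt_min_iff] at hd hd' he he'
    have hδ : dist p'.1 q'.1 < δ := by
      have := dist_triangle4 (g p'.1) (f p.1) (f q.1) (g q'.1)
      rw [dist_comm (g p'.1) (f p.1), hf.dist_eq, hg.dist_eq] at this
      linarith
    have := dist_triangle4 p.2 p'.2 q'.2 q.2
    rw [dist_comm q'.2] at this
    linarith [hL p' hp' q' hq' hδ]

/-- Independence of the representative is the case of distance zero of `hasModulus_of_near`. -/
theorem mk_mem_modulusSet {P : Structured (markedFunctor.{u, v} Ξ)} {δ η : ℝ} :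
    (⟦P⟧ : CSpace (markedFunctor.{u, v} Ξ)) ∈ modulusSet Ξ δ η ↔ HasModulus P.str δ η := by
  refine ⟨?_, fun h => ⟨P, rfl, h⟩⟩
  rintro ⟨Q, hQ, h⟩
  refine hasModulus_of_near fun ε hε => ⟨Q, ?_, h⟩
  rw [← ghfDist_lt_iff, hQ]
  exact (ghfDist_self _).trans_lt hε

variable (Ξ)

/-- Continuous functions on compact spaces are uniformly continuous. Conversely, a modulus for every
`η` forces the marked set to be single-valued, and the resulting function to be continuous. -/
theorem range_graphMap_eq : range (graphMap.{u, v} Ξ) =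
    ⋂ n : ℕ, ⋃ m : ℕ, modulusSet Ξ (1 / ((m : ℝ) + 1)) (1 / ((n : ℝ) + 1)) := by
  ext c
  obtain ⟨⟨X, (K : NonemptyCompacts (X × Ξ))⟩, rfl⟩ := Quotient.exists_rep c
  constructor
  · rintro ⟨p, hp⟩
    obtain ⟨P, rfl⟩ := Quotient.exists_rep p
    rw [← hp]
    refine mem_iInter.2 fun n => mem_iUnion.2 ?_
    obtain ⟨δ, hδ, h⟩ := Metric.uniformContinuous_iff.1
      (CompactSpace.uniformContinuous_of_continuous P.func.continuous) (1 / ((n : ℝ) + 1))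
      (by positivity)
    obtain ⟨m, hm⟩ := exists_nat_one_div_lt hδ
    refine ⟨m, ⟨P.space, graphCompact P.space P.func⟩, rfl, fun x => ⟨_, mem_range_self x⟩, ?_⟩
    rintro _ ⟨x, rfl⟩ _ ⟨y, rfl⟩ hxy
    exact (h (hxy.trans hm)).le
  · intro h
    have h : ∀ n : ℕ, ∃ m : ℕ, HasModulus K (1 / ((m : ℝ) + 1)) (1 / ((n : ℝ) + 1)) := fun n => by
      obtain ⟨m, hm⟩ := mem_iUnion.1 (mem_iInter.1 h n)
      exact ⟨m, mk_mem_modulusSet.1 hm⟩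
    have hunif : ∀ ε > 0, ∃ δ > 0, ∀ p ∈ K, ∀ q ∈ K, dist p.1 q.1 < δ → dist p.2 q.2 < ε := by
      intro ε hε
      obtain ⟨n, hn⟩ := exists_nat_one_div_lt hε
      obtain ⟨m, -, hm⟩ := h n
      exact ⟨1 / ((m : ℝ) + 1), by positivity,
        fun p hp q hq hpq => (hm p hp q hq hpq).trans_lt hn⟩
    obtain ⟨_, hsurj, -⟩ := h 0
    choose φ hφ using hsurj
    -- Two marks over one point are at spatial distance 0, hence closer than every `ε`.
    have huniq : ∀ p ∈ K, φ p.1 = p.2 := by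
      intro p hp
      refine dist_le_zero.1 (le_of_forall_gt fun ε hε => ?_)
      obtain ⟨δ, hδ, h⟩ := hunif ε hε
      exact h _ (hφ p.1) p hp (by simpa)
    have hcont : Continuous φ := by
      refine Metric.continuous_iff.2 fun x ε hε => ?_
      obtain ⟨δ, hδ, h⟩ := hunif ε hε
      exact ⟨δ, hδ, fun y hy => h _ (hφ y) _ (hφ x) hy⟩
    refine ⟨⟦⟨X, ⟨φ, hcont⟩⟩⟧, ?_⟩
    have : graphCompact X ⟨φ, hcont⟩ = K := by
      refine NonemptyCompacts.ext (Subset.antisymm ?_ fun p hp => ⟨p.1, ?_⟩)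
      · rintro _ ⟨x, rfl⟩
        exact hφ x
      · exact Prod.ext rfl (huniq p hp)
    rw [← this]
    rfl

/-! ### The image of `𝒯_*` -/

/-- The map that forgets the root. -/
def forgetRoot : CSpace (pointedMarkedFunctor.{u, v} Ξ) → CSpace (markedFunctor.{u, v} Ξ) :=
  Quotient.map (fun P => ⟨P.space, P.str.2⟩) (by
    rintro P Q ⟨e, he⟩
    exact ⟨e, congrArg Prod.snd he⟩)

theorem ghfDist_forgetRoot_le (p q : CSpace (pointedMarkedFunctor.{u, v} Ξ)) :
    ghfDist _ (forgetRoot Ξ p) (forgetRoot Ξ q) ≤ ghfDist _ p q := by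
  obtain ⟨P, rfl⟩ := Quotient.exists_rep p
  obtain ⟨Q, rfl⟩ := Quotient.exists_rep q
  refine le_of_forall_gt fun r hr => ?_
  obtain ⟨Z, f, g, hf, hg, h1, h2⟩ := (ghfDist_lt_iff _ _ _).1 hr
  exact (ghfDist_lt_iff (τ := markedFunctor.{u, v} Ξ) ⟨P.space, P.str.2⟩ ⟨Q.space, Q.str.2⟩ r).2
    ⟨Z, f, g, hf, hg, h1, (max_lt_iff.1 h2).2⟩

/-- Being a graph does not involve the root, which can be carried back along the isometry. -/
theorem range_pointedGraphMap_eq :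
    range (pointedGraphMap.{u, v} Ξ) = forgetRoot Ξ ⁻¹' range (graphMap.{u, v} Ξ) := by
  ext c
  constructor
  · rintro ⟨p, rfl⟩
    obtain ⟨P, rfl⟩ := Quotient.exists_rep p
    exact ⟨⟦⟨P.space, P.func⟩⟧, rfl⟩
  · rintro ⟨q, hq⟩
    obtain ⟨P, rfl⟩ := Quotient.exists_rep c
    obtain ⟨Q, rfl⟩ := Quotient.exists_rep q
    obtain ⟨e, he⟩ : Structured.Equivalent _ _ := Quotient.exact hq
    refine ⟨⟦⟨Q.space, e.symm P.str.1, Q.func⟩⟧, Quotient.sound ⟨e, Prod.ext ?_ he⟩⟩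
    exact e.apply_symm_apply _

theorem IsFSigmaDelta.preimage {α β : Type*} [TopologicalSpace α] [TopologicalSpace β]
    {S : Set β} (hS : IsFSigmaDelta S) {f : α → β} (hf : Continuous f) :
    IsFSigmaDelta (f ⁻¹' S) := by
  obtain ⟨F, hF, rfl⟩ := hS
  exact ⟨fun n m => f ⁻¹' F n m, fun n m => (hF n m).preimage hf, by
    simp only [preimage_iInter, preimage_iUnion]⟩

theorem IsFSigmaDelta.measurableSet_borel {α : Type*} [TopologicalSpace α] {S : Set α}
    (hS : IsFSigmaDelta S) : @MeasurableSet _ (borel α) S := by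
  let _ := borel α
  have : BorelSpace α := ⟨rfl⟩
  obtain ⟨F, hF, rfl⟩ := hS
  exact .iInter fun n => .iUnion fun m => (hF n m).measurableSet

/-! ### The metrics, closedness of the modulus sets, and the embedding of `𝒯_*` -/

section Metric

variable [CompleteSpace Ξ] [SeparableSpace Ξ]

/-- The metric on `𝒞_τ` for marked compact subsets. -/
@[reducible] def markedMetricSpace : MetricSpace (CSpace (markedFunctor.{u, v} Ξ)) :=
  (markedFunctor_isRegular Ξ).metricSpace

/-- The metric on `𝒞_τ` for pairs of a point and a marked compact subset. -/
@[reducible] def pointedMarkedMetricSpace :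
    MetricSpace (CSpace (pointedMarkedFunctor.{u, v} Ξ)) :=
  (pointedMarkedFunctor_isRegular Ξ).metricSpace

attribute [local instance] markedMetricSpace pointedMarkedMetricSpace

/-- The metric on `𝒯`. -/
@[reducible] def tMetricSpace : MetricSpace (TSpace.{u, v} Ξ) :=
  MetricSpace.induced (graphMap.{u, v} Ξ) (graphMap_injective Ξ) inferInstance

/-- The metric on `𝒯_*`. -/
@[reducible] def pointedTMetricSpace : MetricSpace (PointedTSpace.{u, v} Ξ) where
  dist := pointedTDist
  dist_self := pointedTDist_self
  dist_comm := pointedTDist_comm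
  dist_triangle := pointedTDist_triangle
  -- Separation is inherited from the rooted Gromov–Hausdorff-functor metric, which is dominated by
  -- this distance.
  eq_of_dist_eq_zero h := pointedGraphMap_injective Ξ
    (eq_of_ghfDist_eq_zero (pointedMarkedFunctor_isRegular Ξ)
      (le_antisymm ((ghfDist_pointedGraphMap_le _ _).trans h.le) (ghfDist_nonneg _ _)))

attribute [local instance] tMetricSpace pointedTMetricSpace

theorem isClosed_modulusSet (δ η : ℝ) : IsClosed (modulusSet.{u, v} Ξ δ η) := by
  refine isClosed_of_closure_subset fun c hc => ?_
  obtain ⟨P, rfl⟩ := Quotient.exists_rep c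
  refine mk_mem_modulusSet.2 (hasModulus_of_near fun ε hε => ?_)
  obtain ⟨_, ⟨Q, rfl, hQ⟩, h⟩ := Metric.mem_closure_iff.1 hc ε hε
  exact ⟨Q, (ghfDist_lt_iff _ _ _).1 h, hQ⟩

theorem isFSigmaDelta_range_graphMap : IsFSigmaDelta (range (graphMap.{u, v} Ξ)) :=
  ⟨_, fun _ _ => isClosed_modulusSet Ξ _ _, range_graphMap_eq Ξ⟩

theorem continuous_forgetRoot : Continuous (forgetRoot.{u, v} Ξ) :=
  (LipschitzWith.mk_one (ghfDist_forgetRoot_le Ξ)).continuous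

theorem isFSigmaDelta_range_pointedGraphMap :
    IsFSigmaDelta (range (pointedGraphMap.{u, v} Ξ)) := by
  rw [range_pointedGraphMap_eq]
  exact (isFSigmaDelta_range_graphMap Ξ).preimage (continuous_forgetRoot Ξ)

theorem isEmbedding_pointedGraphMap : Topology.IsEmbedding (pointedGraphMap.{u, v} Ξ) := by
  refine ⟨isInducing_iff_nhds.2 fun q => le_antisymm ?_ ?_, pointedGraphMap_injective Ξ⟩
  · rw [← tendsto_iff_comap]
    exact (LipschitzWith.mk_one ghfDist_pointedGraphMap_le).continuous.tendsto q
  -- Openness onto the image is checked at each point `q` separately, as the radius from the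
  -- preceding estimate depends on `q`.
  · refine (nhds_basis_ball.comap _).le_basis_iff nhds_basis_ball |>.2 fun ε hε => ?_
    exact exists_pointedTDist_lt_of_ghfDist_lt q hε

end Metric

end

end SpatialTrees

end

/-! ### The proposition -/

theorem proposition5p1 (Ξ : Type v) [MetricSpace Ξ] [CompleteSpace Ξ] [SeparableSpace Ξ] :
    (∃ (_ : MetricSpace (SpatialTrees.TSpace.{u, v} Ξ))
        (_ : MetricSpace (SpatialTrees.CSpace (SpatialTrees.markedFunctor.{u, v} Ξ))),
      (∀ p q : SpatialTrees.TSpace.{u, v} Ξ, dist p q = SpatialTrees.tDist p q) ∧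
      (∀ p q : SpatialTrees.CSpace (SpatialTrees.markedFunctor.{u, v} Ξ),
        dist p q = SpatialTrees.ghfDist _ p q) ∧
      CompleteSpace (SpatialTrees.CSpace (SpatialTrees.markedFunctor.{u, v} Ξ)) ∧
      SeparableSpace (SpatialTrees.CSpace (SpatialTrees.markedFunctor.{u, v} Ξ)) ∧
      Isometry (SpatialTrees.graphMap.{u, v} Ξ) ∧
      SpatialTrees.IsFSigmaDelta (range (SpatialTrees.graphMap.{u, v} Ξ)) ∧
      @MeasurableSet _ (borel _) (range (SpatialTrees.graphMap.{u, v} Ξ))) ∧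
    (∃ (_ : MetricSpace (SpatialTrees.PointedTSpace.{u, v} Ξ))
        (_ : MetricSpace (SpatialTrees.CSpace (SpatialTrees.pointedMarkedFunctor.{u, v} Ξ))),
      (∀ p q : SpatialTrees.PointedTSpace.{u, v} Ξ,
        dist p q = SpatialTrees.pointedTDist p q) ∧
      (∀ p q : SpatialTrees.CSpace (SpatialTrees.pointedMarkedFunctor.{u, v} Ξ),
        dist p q = SpatialTrees.ghfDist _ p q) ∧
      CompleteSpace (SpatialTrees.CSpace (SpatialTrees.pointedMarkedFunctor.{u, v} Ξ)) ∧
      SeparableSpace (SpatialTrees.CSpace (SpatialTrees.pointedMarkedFunctor.{u, v} Ξ)) ∧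
      Topology.IsEmbedding (SpatialTrees.pointedGraphMap.{u, v} Ξ) ∧
      SpatialTrees.IsFSigmaDelta (range (SpatialTrees.pointedGraphMap.{u, v} Ξ)) ∧
      @MeasurableSet _ (borel _) (range (SpatialTrees.pointedGraphMap.{u, v} Ξ))) := by
  let _ := SpatialTrees.markedMetricSpace.{u, v} Ξ
  let _ := SpatialTrees.pointedMarkedMetricSpace.{u, v} Ξ
  have hF := SpatialTrees.isFSigmaDelta_range_graphMap.{u, v} Ξ
  have hF' := SpatialTrees.isFSigmaDelta_range_pointedGraphMap.{u, v} Ξ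
  -- The metric on `𝒯` is the one induced by the graph map, so the isometry holds by definition and
  -- the content lies in its agreement with `tDist`.
  exact ⟨⟨SpatialTrees.tMetricSpace Ξ, SpatialTrees.markedMetricSpace Ξ,
      fun p q => (SpatialTrees.tDist_eq_ghfDist p q).symm, fun _ _ => rfl,
      (SpatialTrees.markedFunctor_isRegular Ξ).completeSpace,
      (SpatialTrees.markedFunctor_isRegular Ξ).separableSpace,
      fun _ _ => rfl, hF, hF.measurableSet_borel⟩,
    ⟨SpatialTrees.pointedTMetricSpace Ξ, SpatialTrees.pointedMarkedMetricSpace Ξ,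
      fun _ _ => rfl, fun _ _ => rfl,
      (SpatialTrees.pointedMarkedFunctor_isRegular Ξ).completeSpace,
      (SpatialTrees.pointedMarkedFunctor_isRegular Ξ).separableSpace,
      SpatialTrees.isEmbedding_pointedGraphMap Ξ, hF', hF'.measurableSet_borel⟩⟩
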